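/- Let $n$ be a prime and $\omega=e^{2\pi i/n}$. Let $P=\mathrm{diag}(1,\omega,\dots,\omega^{n-1})$, let $Q$ be the $n\times n$ permutation matrix with entries $Q_{ij}=1$ if $j\equiv i+1 \pmod n$ and $Q_{ij}=0$ otherwise, and let $\mathcal P_n=\{\omega^jP^kQ^l : 0\le j,k,l\le n-1\}$ be the Pauli group. For an invertible complex $n^2\times n^2$ matrix $A$ let $Ad_A$ be the inner automorphism $X\mapsto A^{-1}XA$ of the Lie algebra $sl(n^2,\mathbb C)$, and put $$\mathcal G=\{Ad_{A\otimes B} : A,B\in\mathcal P_n\}\subset \mathrm{Aut}\, sl(n^2,\mathbb C).$$ Let $\mathcal N(\mathcal G)$ be the normalizer of $\mathcal G$ in the group of all Lie algebra automorphisms of $sl(n^2,\mathbb C)$, and $\mathcal N_{in}(\mathcal G)$ its subgroup of inner automorphisms. Put $A_1=P\otimes I$, $A_2=Q\otimes I$, $A_3=I\otimes P$, $A_4=I\otimes Q$. For $\varphi\in\mathcal N(\mathcal G)$ let $C(\varphi)=(a_{ij})\in(\mathbb Z/n)^{4\times4}$ be the unique matrix with $$\varphi\, Ad_{A_j}\,\varphi^{-1}=Ad_{P^{a_{1j}}Q^{a_{2j}}\otimes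 P^{a_{3j}}Q^{a_{4j}}}\qquad (j=1,2,3,4).$$ Let $J=I_2\otimes\begin{pmatrix}0&1\\-1&0\end{pmatrix}$ and $Sp(4,\mathbb F_n)=\{X\in\mathbb F_n^{4\times4} : X^\top JX=J\}$. Then: 1. The map $\varphi\mapsto C(\varphi)$ induces a group isomorphism $\mathcal N_{in}(\mathcal G)/\mathcal G\cong Sp(4,\mathbb F_n)$. 2. If $n$ is odd, the map $\varphi\mapsto C(\varphi)$ induces a group isomorphism $\mathcal N(\mathcal G)/\mathcal G\cong\{X\in\mathbb F_n^{4\times4} : X^\top JX=\pm J\}$. 3. If $n=2$, the map $\varphi\mapsto(C(\varphi),\varepsilon(\varphi))$, where $\varepsilon(\varphi)\in\mathbb Z_2$ is trivial if and only if $\varphi$ is an inner automorphism, induces a group isomorphism $\mathcal N(\mathcal G)/\mathcal G\cong Sp(4,\mathbb F_2)\times\mathbb Z_2$. -/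

import Mathlib

open Matrix
open scoped Kronecker

noncomputable section

namespace PauliGrading

/-! ### Automorphism groups of Lie algebras -/

section Aut

variable {R L : Type*} [CommRing R] [LieRing L] [LieAlgebra R L]

/-- The automorphisms of a Lie algebra form a group under composition: `(φ * ψ) x = φ (ψ x)`. -/
instance lieAutGroup : Group (L ≃ₗ⁅R⁆ L) where
  mul φ ψ := ψ.trans φ
  one := 1
  inv φ := φ.symm
  mul_assoc _ _ _ := rfl
  one_mul _ := rfl
  mul_one _ := rfl
  inv_mul_cancel φ := LieEquiv.ext fun x => φ.symm_apply_apply x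

@[simp] theorem lieAut_mul_apply (φ ψ : L ≃ₗ⁅R⁆ L) (x : L) : (φ * ψ) x = φ (ψ x) := rfl

@[simp] theorem lieAut_one_apply (x : L) : (1 : L ≃ₗ⁅R⁆ L) x = x := rfl

end Aut

/-! ### The Lie algebra `sl` and its inner automorphisms -/

section Inner

variable {ι : Type*} [Fintype ι] [DecidableEq ι]

/-- The inner automorphism `Ad_A X = A⁻¹ X A` of the trace-zero matrices. -/
def Ad (A : GL ι ℂ) : LieAlgebra.SpecialLinear.sl ι ℂ ≃ₗ⁅ℂ⁆ LieAlgebra.SpecialLinear.sl ι ℂ where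
  toFun X := ⟨(↑A⁻¹ : Matrix ι ι ℂ) * X.1 * (A : Matrix ι ι ℂ), by
    have h : Matrix.trace X.1 = 0 := X.2
    change Matrix.trace _ = 0
    rw [Matrix.trace_mul_comm, ← Matrix.mul_assoc, Units.mul_inv, Matrix.one_mul, h]⟩
  invFun X := ⟨(A : Matrix ι ι ℂ) * X.1 * (↑A⁻¹ : Matrix ι ι ℂ), by
    have h : Matrix.trace X.1 = 0 := X.2
    change Matrix.trace _ = 0
    rw [Matrix.trace_mul_comm, ← Matrix.mul_assoc, Units.inv_mul, Matrix.one_mul, h]⟩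
  map_add' X Y := Subtype.ext (by simp [Matrix.mul_add, Matrix.add_mul])
  map_smul' c X := Subtype.ext (by simp)
  map_lie' := by
    intro X Y
    apply Subtype.ext
    have key : ∀ U V : Matrix ι ι ℂ,
        (↑A⁻¹ : Matrix ι ι ℂ) * (U * V) * (A : Matrix ι ι ℂ)
          = ((↑A⁻¹ : Matrix ι ι ℂ) * U * (A : Matrix ι ι ℂ))
            * ((↑A⁻¹ : Matrix ι ι ℂ) * V * (A : Matrix ι ι ℂ)) := by
      intro U V
      have : (A : Matrix ι ι ℂ) * (↑A⁻¹ : Matrix ι ι ℂ) = 1 := Units.mul_inv A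
      calc _ = (↑A⁻¹ : Matrix ι ι ℂ) * U * 1 * V * (A : Matrix ι ι ℂ) := by
              simp only [Matrix.mul_assoc, Matrix.mul_one]
        _ = _ := by rw [← this]; simp only [Matrix.mul_assoc]
    simp only [LieAlgebra.SpecialLinear.sl_bracket, Matrix.mul_sub, Matrix.sub_mul, key]
  left_inv X := Subtype.ext (by
    change (A : Matrix ι ι ℂ) * ((↑A⁻¹ : Matrix ι ι ℂ) * X.1 * (A : Matrix ι ι ℂ)) *
      (↑A⁻¹ : Matrix ι ι ℂ) = X.1
    rw [Matrix.mul_assoc, Matrix.mul_assoc, Matrix.mul_assoc, Units.mul_inv, Matrix.mul_one,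
      ← Matrix.mul_assoc, Units.mul_inv, Matrix.one_mul])
  right_inv X := Subtype.ext (by
    change (↑A⁻¹ : Matrix ι ι ℂ) * ((A : Matrix ι ι ℂ) * X.1 * (↑A⁻¹ : Matrix ι ι ℂ)) *
      (A : Matrix ι ι ℂ) = X.1
    rw [Matrix.mul_assoc, Matrix.mul_assoc, Matrix.mul_assoc, Units.inv_mul, Matrix.mul_one,
      ← Matrix.mul_assoc, Units.inv_mul, Matrix.one_mul])

theorem coe_Ad_apply (A : GL ι ℂ) (X : LieAlgebra.SpecialLinear.sl ι ℂ) :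
    ((Ad A X : LieAlgebra.SpecialLinear.sl ι ℂ) : Matrix ι ι ℂ)
      = (↑A⁻¹ : Matrix ι ι ℂ) * (X : Matrix ι ι ℂ) * (A : Matrix ι ι ℂ) := rfl

theorem Ad_one : Ad (1 : GL ι ℂ) = 1 :=
  LieEquiv.ext fun X => Subtype.ext (by
    rw [coe_Ad_apply, inv_one, Units.val_one, Matrix.one_mul, Matrix.mul_one, lieAut_one_apply])

theorem Ad_mul (A B : GL ι ℂ) : Ad A * Ad B = Ad (B * A) :=
  LieEquiv.ext fun X => Subtype.ext (by simp [coe_Ad_apply, Matrix.mul_assoc])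

theorem Ad_inv (A : GL ι ℂ) : (Ad A)⁻¹ = Ad A⁻¹ :=
  inv_eq_of_mul_eq_one_left (by rw [Ad_mul, mul_inv_cancel, Ad_one])

/-- Proportional matrices give the same inner automorphism. -/
theorem Ad_eq_of_smul {A B : GL ι ℂ} {c : ℂ} (h : (A : Matrix ι ι ℂ) = c • (B : Matrix ι ι ℂ)) :
    Ad A = Ad B := by
  refine LieEquiv.ext fun X => Subtype.ext ?_
  rw [coe_Ad_apply, coe_Ad_apply]
  have e1 : (A : Matrix ι ι ℂ) * ((↑B⁻¹ : Matrix ι ι ℂ) * X.1 * (B : Matrix ι ι ℂ))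
      = X.1 * (A : Matrix ι ι ℂ) := by
    rw [h, Matrix.smul_mul, Matrix.mul_smul, ← Matrix.mul_assoc, ← Matrix.mul_assoc,
      Units.mul_inv, Matrix.one_mul]
  rw [Matrix.mul_assoc, ← e1, ← Matrix.mul_assoc, Units.inv_mul, Matrix.one_mul]

variable (ι) in
/-- The group of inner automorphisms. -/
def innerAut : Subgroup
    (LieAlgebra.SpecialLinear.sl ι ℂ ≃ₗ⁅ℂ⁆ LieAlgebra.SpecialLinear.sl ι ℂ) where
  carrier := {φ | ∃ A : GL ι ℂ, φ = Ad A}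
  mul_mem' := by
    rintro _ _ ⟨A, rfl⟩ ⟨B, rfl⟩
    exact ⟨B * A, Ad_mul A B⟩
  one_mem' := ⟨1, Ad_one.symm⟩
  inv_mem' := by
    rintro _ ⟨A, rfl⟩
    exact ⟨A⁻¹, Ad_inv A⟩

end Inner

/-! ### The Pauli group

The rows and columns of an `n × n` matrix are labelled by the residues `0, 1, …, n - 1`
modulo `n`, those of an `n² × n²` matrix by pairs `(p₁, p₂)` of residues, which stand for
`p₁ n + p₂`. -/

section Pauli

variable (n : ℕ)

/-- `ω = e^{2πi/n}`. -/
def omega : ℂ := Complex.exp (2 * Real.pi * Complex.I / n)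

theorem omega_ne_zero : omega n ≠ 0 := Complex.exp_ne_zero _

variable [NeZero n]

theorem omega_pow : omega n ^ n = 1 := by
  have hn : (n : ℂ) ≠ 0 := Nat.cast_ne_zero.2 (NeZero.ne n)
  rw [omega, ← Complex.exp_nat_mul, mul_div_cancel₀ _ hn, Complex.exp_two_pi_mul_I]

theorem omega_pow_mod (k : ℕ) : omega n ^ (k % n) = omega n ^ k :=
  (pow_eq_pow_mod k (omega_pow n)).symm

/-- `P = diag(1, ω, …, ω^{n-1})`. -/
def P : GL (ZMod n) ℂ where
  val := Matrix.diagonal fun i => omega n ^ i.val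
  inv := Matrix.diagonal fun i => (omega n ^ i.val)⁻¹
  val_inv := by
    simp [Matrix.diagonal_mul_diagonal, omega_ne_zero]
  inv_val := by
    simp [Matrix.diagonal_mul_diagonal, omega_ne_zero]

/-- `Q` has the entry `1` at the places `(i, i + 1)` modulo `n` and `0` elsewhere. -/
def Q : GL (ZMod n) ℂ where
  val := Matrix.of fun i j => if j = i + 1 then 1 else 0
  inv := Matrix.of fun i j => if i = j + 1 then 1 else 0
  val_inv := by
    ext i j
    simp [Matrix.mul_apply, Matrix.one_apply, eq_comm]
  inv_val := by
    ext i j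
    rw [Matrix.mul_apply, Finset.sum_eq_single (i - 1)]
    · simp [Matrix.one_apply, eq_comm]
    · intro k _ hk
      have : i ≠ k + 1 := fun h => hk (by rw [h]; ring)
      simp [this]
    · simp

theorem Q_mul_P : ((Q n * P n : GL (ZMod n) ℂ) : Matrix (ZMod n) (ZMod n) ℂ)
    = omega n • ((P n * Q n : GL (ZMod n) ℂ) : Matrix (ZMod n) (ZMod n) ℂ) := by
  ext i j
  simp only [Units.val_mul, P, Q, Matrix.smul_apply, Matrix.mul_diagonal, Matrix.diagonal_mul,
    Matrix.of_apply, smul_eq_mul]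
  by_cases h : j = i + 1
  · subst h
    simp only [if_true, one_mul, mul_one]
    rw [ZMod.val_add, omega_pow_mod, pow_add, mul_comm]
    congr 1
    rw [ZMod.val_one_eq_one_mod, omega_pow_mod, pow_one]
  · simp [h]

/-- The scalar matrix `ω I`. -/
def omegaUnit : GL (ZMod n) ℂ := Units.map (algebraMap ℂ (Matrix (ZMod n) (ZMod n) ℂ)).toMonoidHom
  (Units.mk0 (omega n) (omega_ne_zero n))

theorem coe_omegaUnit_pow_mul (j : ℕ) (A : GL (ZMod n) ℂ) :
    ((omegaUnit n ^ j * A : GL (ZMod n) ℂ) : Matrix (ZMod n) (ZMod n) ℂ)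
      = omega n ^ j • (A : Matrix (ZMod n) (ZMod n) ℂ) := by
  rw [Units.val_mul, Units.val_pow_eq_pow_val, Algebra.smul_def, map_pow]
  rfl

theorem omegaUnit_comm (A : GL (ZMod n) ℂ) : Commute (omegaUnit n) A :=
  Units.ext (Algebra.commutes (omega n) (A : Matrix (ZMod n) (ZMod n) ℂ))

theorem omegaUnit_pow_n : omegaUnit n ^ n = 1 := by
  rw [omegaUnit, ← map_pow, show Units.mk0 (omega n) (omega_ne_zero n) ^ n = 1 from
    Units.ext (by simp [omega_pow]), map_one]

theorem P_pow_n : P n ^ n = 1 := by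
  apply Units.ext
  rw [Units.val_pow_eq_pow_val]
  change Matrix.diagonal _ ^ n = 1
  rw [Matrix.diagonal_pow, ← Matrix.diagonal_one]
  congr 1
  ext i
  rw [Pi.pow_apply, ← pow_mul, mul_comm, pow_mul, omega_pow, one_pow]

theorem Q_pow_apply (l : ℕ) (i j : ZMod n) :
    ((Q n ^ l : GL (ZMod n) ℂ) : Matrix (ZMod n) (ZMod n) ℂ) i j
      = if j = i + l then 1 else 0 := by
  induction l generalizing i with
  | zero => simp [Matrix.one_apply, eq_comm]
  | succ l ih =>
    rw [pow_succ', Units.val_mul, Matrix.mul_apply, Finset.sum_eq_single (i + 1)]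
    · rw [ih]
      simp [Q, add_assoc, add_comm (l : ZMod n) 1]
    · intro k _ hk
      simp [Q, hk]
    · simp

theorem Q_pow_n : Q n ^ n = 1 := by
  ext i j
  rw [Q_pow_apply]
  simp [Matrix.one_apply, eq_comm]

theorem Q_pow_mul_P_pow (l k : ℕ) :
    Q n ^ l * P n ^ k = omegaUnit n ^ (l * k) * (P n ^ k * Q n ^ l) := by
  have h1 : SemiconjBy (Q n) (P n) (omegaUnit n * P n) := by
    have := Q_mul_P n
    refine Units.ext ?_
    rw [this, mul_assoc]
    simpa using (coe_omegaUnit_pow_mul n 1 (P n * Q n)).symm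
  have h2 : Q n * P n ^ k = omegaUnit n ^ k * P n ^ k * Q n := by
    have := (h1.pow_right k).eq
    rwa [(omegaUnit_comm n (P n)).mul_pow] at this
  induction l with
  | zero => simp
  | succ l ih =>
    have hc : ∀ (m : ℕ) (A : GL (ZMod n) ℂ), A * omegaUnit n ^ m = omegaUnit n ^ m * A :=
      fun m A => ((omegaUnit_comm n A).pow_left m).eq.symm
    calc Q n ^ (l + 1) * P n ^ k = Q n ^ l * (Q n * P n ^ k) := by rw [pow_succ, mul_assoc]
      _ = (Q n ^ l * omegaUnit n ^ k) * P n ^ k * Q n := by rw [h2]; simp only [mul_assoc]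
      _ = omegaUnit n ^ k * (Q n ^ l * P n ^ k) * Q n := by rw [hc]; simp only [mul_assoc]
      _ = omegaUnit n ^ ((l + 1) * k) * (P n ^ k * Q n ^ (l + 1)) := by
        rw [ih, pow_succ (Q n), add_mul, one_mul, add_comm, pow_add]; simp only [mul_assoc]

/-- The group `𝒫_n = {ω^j P^k Q^l : j, k, l = 0, 1, …, n - 1}`, as a set. -/
def pauliSet : Set (GL (ZMod n) ℂ) :=
  {A | ∃ j k l : Fin n, (A : Matrix (ZMod n) (ZMod n) ℂ) =
    omega n ^ (j : ℕ) • ((P n : Matrix (ZMod n) (ZMod n) ℂ) ^ (k : ℕ) *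
      (Q n : Matrix (ZMod n) (ZMod n) ℂ) ^ (l : ℕ))}

theorem mem_pauliSet_iff (A : GL (ZMod n) ℂ) :
    A ∈ pauliSet n ↔ ∃ j k l : ℕ, A = omegaUnit n ^ j * (P n ^ k * Q n ^ l) := by
  constructor
  · rintro ⟨j, k, l, h⟩
    refine ⟨j, k, l, Units.ext ?_⟩
    rw [coe_omegaUnit_pow_mul, h]
    simp
  · rintro ⟨j, k, l, rfl⟩
    have hn : 0 < n := NeZero.pos n
    refine ⟨⟨j % n, Nat.mod_lt _ hn⟩, ⟨k % n, Nat.mod_lt _ hn⟩, ⟨l % n, Nat.mod_lt _ hn⟩, ?_⟩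
    rw [coe_omegaUnit_pow_mul, pow_eq_pow_mod k (P_pow_n n), pow_eq_pow_mod l (Q_pow_n n),
      ← omega_pow_mod]
    simp

/-- The Pauli group `𝒫_n`. -/
def pauliGroup : Subgroup (GL (ZMod n) ℂ) where
  carrier := pauliSet n
  one_mem' := (mem_pauliSet_iff n 1).2 ⟨0, 0, 0, by simp⟩
  mul_mem' := by
    intro A B hA hB
    obtain ⟨j, k, l, rfl⟩ := (mem_pauliSet_iff n A).1 hA
    obtain ⟨j', k', l', rfl⟩ := (mem_pauliSet_iff n B).1 hB
    refine (mem_pauliSet_iff n _).2 ⟨j + j' + l * k', k + k', l + l', ?_⟩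
    have hc : ∀ (m : ℕ) (A : GL (ZMod n) ℂ), A * omegaUnit n ^ m = omegaUnit n ^ m * A :=
      fun m A => ((omegaUnit_comm n A).pow_left m).eq.symm
    calc omegaUnit n ^ j * (P n ^ k * Q n ^ l) * (omegaUnit n ^ j' * (P n ^ k' * Q n ^ l'))
        = omegaUnit n ^ j * ((P n ^ k * Q n ^ l) * omegaUnit n ^ j') * (P n ^ k' * Q n ^ l') := by
          simp only [mul_assoc]
      _ = omegaUnit n ^ j * omegaUnit n ^ j' * (P n ^ k * (Q n ^ l * P n ^ k') * Q n ^ l') := by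
          rw [hc]; simp only [mul_assoc]
      _ = omegaUnit n ^ j * omegaUnit n ^ j' * ((P n ^ k * omegaUnit n ^ (l * k')) *
            (P n ^ k' * Q n ^ l) * Q n ^ l') := by
          rw [Q_pow_mul_P_pow]; simp only [mul_assoc]
      _ = (omegaUnit n ^ j * omegaUnit n ^ j' * omegaUnit n ^ (l * k')) *
            (P n ^ k * P n ^ k' * (Q n ^ l * Q n ^ l')) := by
          rw [hc (l * k') (P n ^ k)]; simp only [mul_assoc]
      _ = _ := by simp only [pow_add]
  inv_mem' := by
    intro A hA
    obtain ⟨j, k, l, rfl⟩ := (mem_pauliSet_iff n A).1 hA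
    obtain ⟨m, hm⟩ : ∃ m, n = m + 1 := ⟨n - 1, (Nat.succ_pred (NeZero.ne n)).symm⟩
    have hinv : ∀ A : GL (ZMod n) ℂ, A ^ n = 1 → A⁻¹ = A ^ m := fun A h => by
      have h' : A ^ (m + 1) = 1 := (congrArg (A ^ ·) hm).symm.trans h
      rw [pow_succ] at h'
      exact (eq_inv_of_mul_eq_one_left h').symm
    refine (mem_pauliSet_iff n _).2 ⟨l * m * (k * m) + j * m, k * m, l * m, ?_⟩
    change (omegaUnit n ^ j * (P n ^ k * Q n ^ l))⁻¹ = _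
    have e : ∀ (A : GL (ZMod n) ℂ) (i : ℕ), A ^ n = 1 → (A ^ i)⁻¹ = A ^ (i * m) := fun A i h => by
      rw [← inv_pow, hinv A h, ← pow_mul, mul_comm]
    rw [_root_.mul_inv_rev, _root_.mul_inv_rev, e _ _ (Q_pow_n n), e _ _ (P_pow_n n), e _ _ (omegaUnit_pow_n n),
      Q_pow_mul_P_pow, ← ((omegaUnit_comm n _).pow_left (j * m)).eq, pow_add, ← mul_assoc,
      ((Commute.refl (omegaUnit n)).pow_pow _ _).eq]

end Pauli

/-! ### The group `𝒢`, its normalizer and the coefficient matrices -/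

section MadGroup

variable (n : ℕ) [NeZero n]

/-- The automorphism group of the Lie algebra `sl(n², ℂ)`. -/
abbrev AutSl : Type :=
  LieAlgebra.SpecialLinear.sl (ZMod n × ZMod n) ℂ ≃ₗ⁅ℂ⁆
    LieAlgebra.SpecialLinear.sl (ZMod n × ZMod n) ℂ

/-- The tensor product `A ⊗ B` of invertible matrices. -/
abbrev tens (A B : GL (ZMod n) ℂ) : GL (ZMod n × ZMod n) ℂ :=
  Matrix.GeneralLinearGroup.kronecker A B

theorem tens_mul (A B A' B' : GL (ZMod n) ℂ) :
    tens n A B * tens n A' B' = tens n (A * A') (B * B') :=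
  Units.ext (Matrix.mul_kronecker_mul _ _ _ _).symm

theorem tens_one : tens n 1 1 = 1 := Units.ext Matrix.one_kronecker_one

theorem tens_inv (A B : GL (ZMod n) ℂ) : (tens n A B)⁻¹ = tens n A⁻¹ B⁻¹ :=
  inv_eq_of_mul_eq_one_left (by rw [tens_mul, inv_mul_cancel, inv_mul_cancel, tens_one])

/-- The group `𝒢 = {Ad_A : A ∈ 𝒫_n ⊗ 𝒫_n}` of automorphisms of `sl(n², ℂ)`. -/
def madGroup : Subgroup (AutSl n) where
  carrier := {φ | ∃ A ∈ pauliGroup n, ∃ B ∈ pauliGroup n, φ = Ad (tens n A B)}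
  mul_mem' := by
    rintro _ _ ⟨A, hA, B, hB, rfl⟩ ⟨A', hA', B', hB', rfl⟩
    exact ⟨A' * A, mul_mem hA' hA, B' * B, mul_mem hB' hB, by rw [Ad_mul, tens_mul]⟩
  one_mem' := ⟨1, one_mem _, 1, one_mem _, by rw [tens_one, Ad_one]⟩
  inv_mem' := by
    rintro _ ⟨A, hA, B, hB, rfl⟩
    exact ⟨A⁻¹, inv_mem hA, B⁻¹, inv_mem hB, by rw [Ad_inv, tens_inv]⟩

/-- The normalizer `𝒩(𝒢)` of `𝒢` in the automorphism group. -/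
abbrev N : Subgroup (AutSl n) := Subgroup.normalizer (madGroup n : Set (AutSl n))

/-- `𝒢` as a subgroup of `𝒩(𝒢)`. -/
abbrev GinN : Subgroup (N n) := (madGroup n).subgroupOf (N n)

/-- The subgroup `𝒩_in(𝒢)` of the inner automorphisms in `𝒩(𝒢)`. -/
abbrev Nin : Subgroup (N n) := (innerAut (ZMod n × ZMod n)).subgroupOf (N n)

/-- `P^a Q^b ⊗ P^c Q^d` for `v = (a, b, c, d)`. -/
def pauliMonomial (v : Fin 4 → ZMod n) : GL (ZMod n × ZMod n) ℂ :=
  tens n (P n ^ (v 0).val * Q n ^ (v 1).val) (P n ^ (v 2).val * Q n ^ (v 3).val)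

/-- The matrices `A₁ = P ⊗ I`, `A₂ = Q ⊗ I`, `A₃ = I ⊗ P`, `A₄ = I ⊗ Q`. -/
def gen : Fin 4 → GL (ZMod n × ZMod n) ℂ :=
  ![tens n (P n) 1, tens n (Q n) 1, tens n 1 (P n), tens n 1 (Q n)]

/-- `X` is a matrix of coefficients `a_{ij}` of the automorphism `φ`: for every column `j`,
`φ Ad_{A_j} φ⁻¹ = Ad_{P^{a_{1j}} Q^{a_{2j}} ⊗ P^{a_{3j}} Q^{a_{4j}}}`. -/
def IsCoeffMatrix (φ : AutSl n) (X : Matrix (Fin 4) (Fin 4) (ZMod n)) : Prop :=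
  ∀ j : Fin 4, φ * Ad (gen n j) * φ⁻¹ = Ad (pauliMonomial n fun i => X i j)

theorem Ad_gen_mem (j : Fin 4) : Ad (gen n j) ∈ madGroup n := by
  have hP : P n ∈ pauliGroup n := (mem_pauliSet_iff n _).2 ⟨0, 1, 0, by simp⟩
  have hQ : Q n ∈ pauliGroup n := (mem_pauliSet_iff n _).2 ⟨0, 0, 1, by simp⟩
  fin_cases j
  · exact ⟨_, hP, _, one_mem _, rfl⟩
  · exact ⟨_, hQ, _, one_mem _, rfl⟩
  · exact ⟨_, one_mem _, _, hP, rfl⟩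
  · exact ⟨_, one_mem _, _, hQ, rfl⟩

theorem exists_monomial {φ : AutSl n} (h : φ ∈ madGroup n) :
    ∃ v : Fin 4 → ZMod n, φ = Ad (pauliMonomial n v) := by
  obtain ⟨A, ⟨j, k, l, hA⟩, B, ⟨j', k', l', hB⟩, rfl⟩ := h
  refine ⟨![(k : ℕ), (l : ℕ), (k' : ℕ), (l' : ℕ)],
    Ad_eq_of_smul (c := omega n ^ (j : ℕ) * omega n ^ (j' : ℕ)) ?_⟩
  have hv : ∀ m : Fin n, (((m : ℕ) : ZMod n)).val = m := fun m => ZMod.val_cast_of_lt m.2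
  change (A : Matrix (ZMod n) (ZMod n) ℂ) ⊗ₖ (B : Matrix (ZMod n) (ZMod n) ℂ) =
    (omega n ^ (j : ℕ) * omega n ^ (j' : ℕ)) • (_ ⊗ₖ _)
  rw [hA, hB, Matrix.smul_kronecker, Matrix.kronecker_smul, smul_smul]
  simp [hv]

theorem exists_isCoeffMatrix (φ : N n) : ∃ X, IsCoeffMatrix n φ X := by
  have h : ∀ j : Fin 4, ∃ v : Fin 4 → ZMod n,
      (φ : AutSl n) * Ad (gen n j) * (φ : AutSl n)⁻¹ = Ad (pauliMonomial n v) := fun j =>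
    exists_monomial n ((Subgroup.mem_normalizer_iff.1 φ.2 _).1 (Ad_gen_mem n j))
  choose v hv using h
  exact ⟨Matrix.of fun i j => v j i, hv⟩

/-- The matrix `C(φ)` of `φ ∈ 𝒩(𝒢)`. It is the only coefficient matrix of `φ`, see
`isCoeffMatrix_iff`. -/
def C (φ : N n) : Matrix (Fin 4) (Fin 4) (ZMod n) := Classical.choose (exists_isCoeffMatrix n φ)

theorem isCoeffMatrix_C (φ : N n) : IsCoeffMatrix n φ (C n φ) :=
  Classical.choose_spec (exists_isCoeffMatrix n φ)

theorem conj_gen_aux {U V X : GL (ZMod n × ZMod n) ℂ} {a b : ℕ} (h : Ad U = Ad V)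
    (hU : (X : Matrix (ZMod n × ZMod n) (ZMod n × ZMod n) ℂ) * (U : Matrix (ZMod n × ZMod n) (ZMod n × ZMod n) ℂ) = omega n ^ a • ((U : Matrix (ZMod n × ZMod n) (ZMod n × ZMod n) ℂ) * (X : Matrix (ZMod n × ZMod n) (ZMod n × ZMod n) ℂ)))
    (hV : (X : Matrix (ZMod n × ZMod n) (ZMod n × ZMod n) ℂ) * (V : Matrix (ZMod n × ZMod n) (ZMod n × ZMod n) ℂ) = omega n ^ b • ((V : Matrix (ZMod n × ZMod n) (ZMod n × ZMod n) ℂ) * (X : Matrix (ZMod n × ZMod n) (ZMod n × ZMod n) ℂ))) :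
    omega n ^ a = omega n ^ b := by
  have conj : ∀ {W : GL (ZMod n × ZMod n) ℂ} {c : ℕ},
      (X : Matrix (ZMod n × ZMod n) (ZMod n × ZMod n) ℂ) * (W : Matrix (ZMod n × ZMod n) (ZMod n × ZMod n) ℂ) = omega n ^ c • ((W : Matrix (ZMod n × ZMod n) (ZMod n × ZMod n) ℂ) * (X : Matrix (ZMod n × ZMod n) (ZMod n × ZMod n) ℂ)) →
      (↑W⁻¹ : Matrix (ZMod n × ZMod n) (ZMod n × ZMod n) ℂ) * (X : Matrix (ZMod n × ZMod n) (ZMod n × ZMod n) ℂ) * (W : Matrix (ZMod n × ZMod n) (ZMod n × ZMod n) ℂ) =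
        omega n ^ c • (X : Matrix (ZMod n × ZMod n) (ZMod n × ZMod n) ℂ) := by
    intro W c hW
    rw [Matrix.mul_assoc, hW, Matrix.mul_smul, ← Matrix.mul_assoc, Units.inv_mul,
      Matrix.one_mul]
  -- subtract a scalar matrix from `X` to make the trace vanish
  set N' : ℂ := (Fintype.card (ZMod n × ZMod n) : ℂ) with hN'
  have hN0 : N' ≠ 0 := Nat.cast_ne_zero.2 Fintype.card_ne_zero
  set t : ℂ := Matrix.trace (X : Matrix (ZMod n × ZMod n) (ZMod n × ZMod n) ℂ) / N' with ht
  have h0 : Matrix.trace ((X : Matrix (ZMod n × ZMod n) (ZMod n × ZMod n) ℂ) -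
      t • (1 : Matrix (ZMod n × ZMod n) (ZMod n × ZMod n) ℂ)) = 0 := by
    rw [Matrix.trace_sub, Matrix.trace_smul, Matrix.trace_one, ← hN', ht, smul_eq_mul,
      div_mul_cancel₀ _ hN0, sub_self]
  have hk := congrArg Subtype.val (DFunLike.congr_fun h ⟨_, h0⟩)
  rw [coe_Ad_apply, coe_Ad_apply] at hk
  simp only [Matrix.mul_sub, Matrix.sub_mul, Matrix.mul_smul, Matrix.smul_mul, Matrix.mul_one,
    Units.inv_mul] at hk
  rw [conj hU, conj hV] at hk
  have hk' : omega n ^ a • (X : Matrix (ZMod n × ZMod n) (ZMod n × ZMod n) ℂ) = omega n ^ b • (X : Matrix (ZMod n × ZMod n) (ZMod n × ZMod n) ℂ) :=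
    sub_left_injective hk
  have hX : (X : Matrix (ZMod n × ZMod n) (ZMod n × ZMod n) ℂ) ≠ 0 := X.ne_zero
  exact smul_left_injective ℂ hX hk'

theorem omega_pow_inj {a b : ZMod n} (h : omega n ^ a.val = omega n ^ b.val) : a = b :=
  ZMod.val_injective n ((Complex.isPrimitiveRoot_exp n (NeZero.ne n)).pow_inj
    (ZMod.val_lt a) (ZMod.val_lt b) h)

theorem pauliMonomial_injective {u v : Fin 4 → ZMod n}
    (h : Ad (pauliMonomial n u) = Ad (pauliMonomial n v)) : u = v := by
  have hQ : ∀ a b : ℕ, (Q n : Matrix (ZMod n) (ZMod n) ℂ) * ((P n ^ a * Q n ^ b : GL (ZMod n) ℂ) : Matrix (ZMod n) (ZMod n) ℂ) =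
      omega n ^ a • (((P n ^ a * Q n ^ b : GL (ZMod n) ℂ) : Matrix (ZMod n) (ZMod n) ℂ) * (Q n : Matrix (ZMod n) (ZMod n) ℂ)) := by
    intro a b
    rw [← Units.val_mul, ← Units.val_mul, ← coe_omegaUnit_pow_mul]
    congr 1
    have := Q_pow_mul_P_pow n 1 a
    rw [pow_one, one_mul] at this
    rw [← mul_assoc, this, mul_assoc, mul_assoc, mul_assoc, ← pow_succ, ← pow_succ']
  have hP : ∀ a b : ℕ, (((P n)⁻¹ : GL (ZMod n) ℂ) : Matrix (ZMod n) (ZMod n) ℂ) *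
      ((P n ^ a * Q n ^ b : GL (ZMod n) ℂ) : Matrix (ZMod n) (ZMod n) ℂ) =
      omega n ^ b • (((P n ^ a * Q n ^ b : GL (ZMod n) ℂ) : Matrix (ZMod n) (ZMod n) ℂ) *
        (((P n)⁻¹ : GL (ZMod n) ℂ) : Matrix (ZMod n) (ZMod n) ℂ)) := by
    intro a b
    rw [← Units.val_mul, ← Units.val_mul, ← coe_omegaUnit_pow_mul]
    congr 1
    have := Q_pow_mul_P_pow n b 1
    rw [pow_one, mul_one] at this
    have e1 : (P n)⁻¹ * P n ^ a = P n ^ a * (P n)⁻¹ :=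
      (((Commute.refl (P n)).inv_left).pow_right a).eq
    have e2 : (P n)⁻¹ * omegaUnit n ^ b = omegaUnit n ^ b * (P n)⁻¹ :=
      ((omegaUnit_comm n (P n)⁻¹).pow_left b).eq.symm
    have e3 : P n ^ a * omegaUnit n ^ b = omegaUnit n ^ b * P n ^ a :=
      ((omegaUnit_comm n (P n ^ a)).pow_left b).eq.symm
    have e4 : Q n ^ b = omegaUnit n ^ b * (P n * Q n ^ b) * (P n)⁻¹ :=
      eq_mul_inv_of_mul_eq this
    calc (P n)⁻¹ * (P n ^ a * Q n ^ b) = P n ^ a * ((P n)⁻¹ * Q n ^ b) := by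
          rw [← mul_assoc, e1, mul_assoc]
      _ = P n ^ a * ((P n)⁻¹ * (omegaUnit n ^ b * (P n * Q n ^ b) * (P n)⁻¹)) := by rw [← e4]
      _ = P n ^ a * (((P n)⁻¹ * omegaUnit n ^ b) * (P n * Q n ^ b) * (P n)⁻¹) := by
          simp only [mul_assoc]
      _ = (P n ^ a * omegaUnit n ^ b) * (Q n ^ b * (P n)⁻¹) := by
          rw [e2]; simp only [mul_assoc, inv_mul_cancel_left]
      _ = omegaUnit n ^ b * (P n ^ a * Q n ^ b * (P n)⁻¹) := by
          rw [e3]; simp only [mul_assoc]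
  have left : ∀ (S : GL (ZMod n) ℂ) (e : ℕ → ℕ → ℕ), (∀ a b : ℕ,
      (S : Matrix (ZMod n) (ZMod n) ℂ) * ((P n ^ a * Q n ^ b : GL (ZMod n) ℂ) : Matrix (ZMod n) (ZMod n) ℂ) =
      omega n ^ e a b • (((P n ^ a * Q n ^ b : GL (ZMod n) ℂ) : Matrix (ZMod n) (ZMod n) ℂ) * (S : Matrix (ZMod n) (ZMod n) ℂ))) →
      ∀ w : Fin 4 → ZMod n, (tens n S 1 : Matrix (ZMod n × ZMod n) (ZMod n × ZMod n) ℂ) * (pauliMonomial n w : Matrix (ZMod n × ZMod n) (ZMod n × ZMod n) ℂ)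
        = omega n ^ e (w 0).val (w 1).val • ((pauliMonomial n w : Matrix (ZMod n × ZMod n) (ZMod n × ZMod n) ℂ) *
          (tens n S 1 : Matrix (ZMod n × ZMod n) (ZMod n × ZMod n) ℂ)) := by
    intro S e hS w
    change ((S : Matrix (ZMod n) (ZMod n) ℂ) ⊗ₖ (1 : Matrix (ZMod n) (ZMod n) ℂ)) * (_ ⊗ₖ _) = _ • ((_ ⊗ₖ _) *
      ((S : Matrix (ZMod n) (ZMod n) ℂ) ⊗ₖ (1 : Matrix (ZMod n) (ZMod n) ℂ)))
    rw [← Matrix.mul_kronecker_mul, ← Matrix.mul_kronecker_mul, hS,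
      Matrix.smul_kronecker, Matrix.one_mul, Matrix.mul_one]
  have right : ∀ (S : GL (ZMod n) ℂ) (e : ℕ → ℕ → ℕ), (∀ a b : ℕ,
      (S : Matrix (ZMod n) (ZMod n) ℂ) * ((P n ^ a * Q n ^ b : GL (ZMod n) ℂ) : Matrix (ZMod n) (ZMod n) ℂ) =
      omega n ^ e a b • (((P n ^ a * Q n ^ b : GL (ZMod n) ℂ) : Matrix (ZMod n) (ZMod n) ℂ) * (S : Matrix (ZMod n) (ZMod n) ℂ))) →
      ∀ w : Fin 4 → ZMod n, (tens n 1 S : Matrix (ZMod n × ZMod n) (ZMod n × ZMod n) ℂ) * (pauliMonomial n w : Matrix (ZMod n × ZMod n) (ZMod n × ZMod n) ℂ)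
        = omega n ^ e (w 2).val (w 3).val • ((pauliMonomial n w : Matrix (ZMod n × ZMod n) (ZMod n × ZMod n) ℂ) *
          (tens n 1 S : Matrix (ZMod n × ZMod n) (ZMod n × ZMod n) ℂ)) := by
    intro S e hS w
    change ((1 : Matrix (ZMod n) (ZMod n) ℂ) ⊗ₖ (S : Matrix (ZMod n) (ZMod n) ℂ)) * (_ ⊗ₖ _) = _ • ((_ ⊗ₖ _) *
      ((1 : Matrix (ZMod n) (ZMod n) ℂ) ⊗ₖ (S : Matrix (ZMod n) (ZMod n) ℂ)))
    rw [← Matrix.mul_kronecker_mul, ← Matrix.mul_kronecker_mul, hS,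
      Matrix.kronecker_smul, Matrix.one_mul, Matrix.mul_one]
  funext i
  apply omega_pow_inj
  fin_cases i
  · exact conj_gen_aux n h (left _ (fun a _ => a) hQ u) (left _ (fun a _ => a) hQ v)
  · exact conj_gen_aux n h (left _ (fun _ b => b) hP u) (left _ (fun _ b => b) hP v)
  · exact conj_gen_aux n h (right _ (fun a _ => a) hQ u) (right _ (fun a _ => a) hQ v)
  · exact conj_gen_aux n h (right _ (fun _ b => b) hP u) (right _ (fun _ b => b) hP v)

theorem isCoeffMatrix_iff (φ : N n) (X : Matrix (Fin 4) (Fin 4) (ZMod n)) :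
    IsCoeffMatrix n φ X ↔ X = C n φ := by
  refine ⟨fun h => ?_, fun h => h ▸ isCoeffMatrix_C n φ⟩
  ext i j
  exact congrFun (pauliMonomial_injective n ((h j).symm.trans (isCoeffMatrix_C n φ j))) i

end MadGroup

/-! ### The symplectic groups -/

section Symplectic

variable (n : ℕ)

/-- `J = I₂ ⊗ [[0, 1], [-1, 0]]`. -/
def J : Matrix (Fin 4) (Fin 4) (ZMod n) :=
  !![0, 1, 0, 0; -1, 0, 0, 0; 0, 0, 0, 1; 0, 0, -1, 0]

theorem conj_inv_aux {X : GL (Fin 4) (ZMod n)} {Y Z : Matrix (Fin 4) (Fin 4) (ZMod n)}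
    (h : (X : Matrix (Fin 4) (Fin 4) (ZMod n))ᵀ * Y * (X : Matrix (Fin 4) (Fin 4) (ZMod n)) = Z) :
    (↑X⁻¹ : Matrix (Fin 4) (Fin 4) (ZMod n))ᵀ * Z * (↑X⁻¹ : Matrix (Fin 4) (Fin 4) (ZMod n))
      = Y := by
  have h1 : (X : Matrix (Fin 4) (Fin 4) (ZMod n)) * (↑X⁻¹ : Matrix (Fin 4) (Fin 4) (ZMod n)) = 1 :=
    Units.mul_inv X
  have h2 : (↑X⁻¹ : Matrix (Fin 4) (Fin 4) (ZMod n))ᵀ *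
      (X : Matrix (Fin 4) (Fin 4) (ZMod n))ᵀ = 1 := by
    rw [← Matrix.transpose_mul, h1, Matrix.transpose_one]
  calc _ = ((↑X⁻¹ : Matrix (Fin 4) (Fin 4) (ZMod n))ᵀ *
        (X : Matrix (Fin 4) (Fin 4) (ZMod n))ᵀ) * Y * ((X : Matrix (Fin 4) (Fin 4) (ZMod n)) *
          (↑X⁻¹ : Matrix (Fin 4) (Fin 4) (ZMod n))) := by rw [← h]; simp only [Matrix.mul_assoc]
    _ = Y := by rw [h1, h2, Matrix.one_mul, Matrix.mul_one]

theorem conj_mul_aux {X X' : GL (Fin 4) (ZMod n)} {Y Z W : Matrix (Fin 4) (Fin 4) (ZMod n)}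
    (h : (X : Matrix (Fin 4) (Fin 4) (ZMod n))ᵀ * Y * (X : Matrix (Fin 4) (Fin 4) (ZMod n)) = Z)
    (h' : (X' : Matrix (Fin 4) (Fin 4) (ZMod n))ᵀ * Z * (X' : Matrix (Fin 4) (Fin 4) (ZMod n))
      = W) :
    (↑(X * X') : Matrix (Fin 4) (Fin 4) (ZMod n))ᵀ * Y *
      (↑(X * X') : Matrix (Fin 4) (Fin 4) (ZMod n)) = W := by
  rw [← h', ← h, Units.val_mul, Matrix.transpose_mul]
  simp only [Matrix.mul_assoc]

/-- Every `X` with `Xᵀ J X = ± J` is invertible. -/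
theorem isUnit_of_conj {X : Matrix (Fin 4) (Fin 4) (ZMod n)}
    (h : Xᵀ * J n * X = J n ∨ Xᵀ * J n * X = -J n) : IsUnit X := by
  have hJ : J n * -J n = 1 := by
    ext i j
    fin_cases i <;> fin_cases j <;> simp [J, Matrix.mul_apply, Fin.sum_univ_four]
  have hJ' : -J n * J n = 1 := by rw [Matrix.neg_mul, ← Matrix.mul_neg, hJ]
  have : ∃ Y, Y * X = 1 := by
    rcases h with h | h
    · exact ⟨-J n * (Xᵀ * J n), by rw [Matrix.mul_assoc, h, hJ']⟩
    · exact ⟨J n * (Xᵀ * J n), by rw [Matrix.mul_assoc, h, hJ]⟩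
  obtain ⟨Y, hY⟩ := this
  exact IsUnit.of_mul_eq_one Y (mul_eq_one_comm.1 hY)

/-- The group `Sp(4, ℤ/n)` of the `4 × 4` matrices `X` with `Xᵀ J X = J`. -/
def Sp4 : Subgroup (GL (Fin 4) (ZMod n)) where
  carrier := {X | (X : Matrix (Fin 4) (Fin 4) (ZMod n))ᵀ * J n *
    (X : Matrix (Fin 4) (Fin 4) (ZMod n)) = J n}
  mul_mem' h h' := conj_mul_aux n h h'
  one_mem' := by simp
  inv_mem' h := conj_inv_aux n h

/-- The group of the `4 × 4` matrices `X` with `Xᵀ J X = ± J`. -/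
def SpPM4 : Subgroup (GL (Fin 4) (ZMod n)) where
  carrier := {X | (X : Matrix (Fin 4) (Fin 4) (ZMod n))ᵀ * J n *
      (X : Matrix (Fin 4) (Fin 4) (ZMod n)) = J n ∨
    (X : Matrix (Fin 4) (Fin 4) (ZMod n))ᵀ * J n *
      (X : Matrix (Fin 4) (Fin 4) (ZMod n)) = -J n}
  mul_mem' := by
    have neg : ∀ {X : GL (Fin 4) (ZMod n)} {Y Z : Matrix (Fin 4) (Fin 4) (ZMod n)},
        (X : Matrix (Fin 4) (Fin 4) (ZMod n))ᵀ * Y * (X : Matrix (Fin 4) (Fin 4) (ZMod n)) = Z →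
        (X : Matrix (Fin 4) (Fin 4) (ZMod n))ᵀ * (-Y) *
          (X : Matrix (Fin 4) (Fin 4) (ZMod n)) = -Z := by
      intro X Y Z h
      rw [Matrix.mul_neg, Matrix.neg_mul, h]
    rintro X X' (h | h) (h' | h')
    · exact Or.inl (conj_mul_aux n h h')
    · exact Or.inr (conj_mul_aux n h h')
    · exact Or.inr (conj_mul_aux n h (neg h'))
    · exact Or.inl (conj_mul_aux n h (by simpa using neg h'))
  one_mem' := Or.inl (by simp)
  inv_mem' := by
    rintro X (h | h)
    · exact Or.inl (conj_inv_aux n h)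
    · refine Or.inr ?_
      have := conj_inv_aux n h
      rw [Matrix.mul_neg, Matrix.neg_mul] at this
      exact neg_eq_iff_eq_neg.1 this

end Symplectic

end PauliGrading

end

/-!
Write `V = (ℤ/n)⁴`, let `X_v` for `v ∈ V` be the Pauli monomials `P^a Q^b ⊗ P^c Q^d` and let
`σ(u, v) = uᵀ J v`. The `X_v` satisfy `X_u X_v = ω ^ β(u, v) X_{u + v}` for a bilinear form `β` with
`β(v, u) - β(u, v) = σ(u, v)`, and they form a basis of the space of all matrices. The group `𝒢`
consists of the `Ad_{X_v}`, which are diagonal in this basis, and its weight spaces are the lines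
`ℂ X_u`, since `σ` is nondegenerate. Hence `φ ∈ 𝒩(𝒢)`, extended to all matrices by `φ(1) = 1`, is
monomial: `φ(X_u) = c_u X_{Du}`, where `D` is contragredient to `C(φ)` for `σ` (`exists_weights`).
No description of the full automorphism group of `sl` is needed; all follows from comparing the
images of commutators of monomials.

*The image lies in the (extended) symplectic group.* The commutator `[X_u, X_v]` vanishes exactly if
`σ(u, v) = 0`, so `D` preserves orthogonality and `σ(Du, Dv) = k σ(u, v)` for a constant `k`. The
absolute values of the structure constants give
`‖c_u‖ ‖c_v‖ ‖1 - ω^{ks}‖ = ‖c_{u + v}‖ ‖1 - ω^s‖` with `s = σ(u, v)`; products over the translates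
of `v` by multiples of `u` and then over all `s ≠ 0` force `‖1 - ω^k‖ = ‖1 - ω‖`, that is, `k = ± 1`
(`multiplier_eq`). An inner automorphism is multiplicative, which gives `k = 1`.

*Surjectivity.* For a symplectic matrix `X` the form `β(Xu, Xv) - β(u, v)` is symmetric, so the
`2`-cocycle of `V` defined by it is a coboundary (`exists_coboundary`). Therefore
`X_v ↦ d_v X_{Xv}`, with suitable scalars `d_v`, is an automorphism of the matrix algebra, which is
inner by the Skolem–Noether theorem. The automorphism `X ↦ -Xᵀ` has a coefficient matrix with
multiplier `-1`.

*The kernel.* If `C(φ) = 1`, then `φ(X_u) = c_u X_u` with `c_{u + v} = c_u c_v` whenever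
`σ(u, v) ≠ 0`. If `c` is multiplicative on all of `V`, it is a character `u ↦ ω ^ σ(v, u)` and
`φ = Ad_{X_v} ∈ 𝒢`. This holds for inner `φ`, and for all `φ` if `n` is odd, because then some `w`
is orthogonal to none of `u`, `v`, `u + v` (`multiplicative_of_noncommuting`). For `n = 2` the only
obstruction is a sign `c_{e₀ + e₂} = ± c_{e₀} c_{e₂}`. The automorphism `X ↦ -Xᵀ` is in the kernel
and has the sign `-1`; it follows that it is not inner and that the inner automorphisms have index two
in `𝒩(𝒢)` (`index_Nin_two`).
-/

open Matrix
open scoped Kronecker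

noncomputable section

namespace PauliGrading

/-! ### The bilinear forms -/

section Forms

variable {n : ℕ}

/-- The bilinear form with `X_u X_v = ω ^ β(u, v) X_{u + v}`. -/
def beta (u v : Fin 4 → ZMod n) : ZMod n := u 1 * v 0 + u 3 * v 2

/-- The symplectic form `uᵀ J v`. -/
def sform (u v : Fin 4 → ZMod n) : ZMod n := u 0 * v 1 - u 1 * v 0 + u 2 * v 3 - u 3 * v 2

theorem sform_eq_dotProduct (u v : Fin 4 → ZMod n) : sform u v = u ⬝ᵥ (J n *ᵥ v) := by
  simp [sform, J, dotProduct, mulVec, Fin.sum_univ_four]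
  ring

theorem sform_eq_beta (u v : Fin 4 → ZMod n) : sform u v = beta v u - beta u v := by
  simp only [sform, beta]; ring

theorem sform_add_left (u v w : Fin 4 → ZMod n) : sform (u + v) w = sform u w + sform v w := by
  simp only [sform, Pi.add_apply]; ring

theorem sform_add_right (u v w : Fin 4 → ZMod n) : sform u (v + w) = sform u v + sform u w := by
  simp only [sform, Pi.add_apply]; ring

theorem sform_smul_left (a : ZMod n) (u v : Fin 4 → ZMod n) :
    sform (a • u) v = a * sform u v := by
  simp only [sform, Pi.smul_apply, smul_eq_mul]; ring

theorem sform_smul_right (a : ZMod n) (u v : Fin 4 → ZMod n) :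
    sform u (a • v) = a * sform u v := by
  simp only [sform, Pi.smul_apply, smul_eq_mul]; ring

theorem sform_self (u : Fin 4 → ZMod n) : sform u u = 0 := by
  simp only [sform]; ring

theorem sform_swap (u v : Fin 4 → ZMod n) : sform u v = -sform v u := by
  simp only [sform]; ring

theorem sform_zero_right (v : Fin 4 → ZMod n) : sform v 0 = 0 := by simp [sform]

/-- The symplectic form is nondegenerate. -/
theorem eq_of_forall_sform_eq {u v : Fin 4 → ZMod n} (h : ∀ w, sform w u = sform w v) :
    u = v := by
  funext i
  have h0 := h (Pi.single 0 1)
  have h1 := h (Pi.single 1 1)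
  have h2 := h (Pi.single 2 1)
  have h3 := h (Pi.single 3 1)
  simp [sform] at h0 h1 h2 h3
  fin_cases i <;> assumption

theorem exists_sform_ne_zero {u : Fin 4 → ZMod n} (hu : u ≠ 0) : ∃ w, sform u w ≠ 0 := by
  by_contra! h
  exact hu (eq_of_forall_sform_eq fun w => by rw [sform_swap, h, sform_zero_right, neg_zero])

end Forms

/-! ### The Pauli monomials as a twisted group algebra -/

section Monomials

variable (n : ℕ) [NeZero n]

/-- The standard additive character `a ↦ ω ^ a` of `ℤ/n`. -/
abbrev e : AddChar (ZMod n) ℂ := ZMod.stdAddChar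

/-- The matrix `X_v = P^a Q^b ⊗ P^c Q^d` of `v = (a, b, c, d)`. -/
abbrev mon (v : Fin 4 → ZMod n) : Matrix (ZMod n × ZMod n) (ZMod n × ZMod n) ℂ :=
  (pauliMonomial n v : Matrix (ZMod n × ZMod n) (ZMod n × ZMod n) ℂ)

variable {n}

theorem omega_pow_eq_e (k : ℕ) : omega n ^ k = e n (k : ZMod n) := by
  have := ZMod.stdAddChar_coe (N := n) (k : ℤ)
  rw [Int.cast_natCast] at this
  rw [this, omega, ← Complex.exp_nat_mul]
  congr 1
  push_cast
  ring

theorem e_injective : Function.Injective (e n) := ZMod.injective_stdAddChar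

theorem norm_e (a : ZMod n) : ‖e n a‖ = 1 := AddChar.norm_apply _ a

theorem e_ne_zero (a : ZMod n) : e n a ≠ 0 := by
  rw [← norm_ne_zero_iff, norm_e]; exact one_ne_zero

theorem e_eq_one_iff {a : ZMod n} : e n a = 1 ↔ a = 0 := by
  rw [← (e n).map_zero_eq_one]; exact e_injective.eq_iff

theorem mon_apply (v : Fin 4 → ZMod n) (p q : ZMod n × ZMod n) :
    mon n v p q = if q = p + (v 1, v 3) then e n (v 0 * p.1 + v 2 * p.2) else 0 := by
  have h1 : ∀ (a b i j : ZMod n),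
      ((P n ^ a.val * Q n ^ b.val : GL (ZMod n) ℂ) : Matrix (ZMod n) (ZMod n) ℂ) i j
        = if j = i + b then e n (a * i) else 0 := by
    intro a b i j
    have hP : ((P n ^ a.val : GL (ZMod n) ℂ) : Matrix (ZMod n) (ZMod n) ℂ)
        = Matrix.diagonal fun i => e n (a * i) := by
      rw [Units.val_pow_eq_pow_val]
      change Matrix.diagonal _ ^ _ = _
      rw [Matrix.diagonal_pow]
      congr 1
      ext i
      rw [Pi.pow_apply, ← pow_mul, omega_pow_eq_e]
      simp [mul_comm]
    rw [Units.val_mul, hP, Matrix.diagonal_mul, Q_pow_apply]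
    simp
  obtain ⟨p1, p2⟩ := p
  obtain ⟨q1, q2⟩ := q
  refine (congrArg₂ (· * ·) (h1 (v 0) (v 1) p1 q1) (h1 (v 2) (v 3) p2 q2)).trans ?_
  rw [ AddChar.map_add_eq_mul]
  by_cases ha : q1 = p1 + v 1 <;> by_cases hb : q2 = p2 + v 3 <;> simp [ha, hb]

theorem mon_mul (u v : Fin 4 → ZMod n) : mon n u * mon n v = e n (beta u v) • mon n (u + v) := by
  ext p q
  rw [Matrix.mul_apply, Finset.sum_eq_single (p + (u 1, u 3))]
  · simp only [mon_apply, Matrix.smul_apply, if_true, smul_eq_mul, Pi.add_apply, Prod.fst_add,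
      Prod.snd_add]
    have : p + (u 1, u 3) + (v 1, v 3) = p + (u 1 + v 1, u 3 + v 3) := by
      ext <;> simp [add_assoc]
    rw [this]
    split_ifs
    · rw [← AddChar.map_add_eq_mul, ← AddChar.map_add_eq_mul]
      congr 1
      simp only [beta]; ring
    · simp
  · intro r _ hr
    rw [mon_apply, if_neg hr, zero_mul]
  · simp

theorem mon_zero : mon n 0 = 1 := by
  ext p q
  rw [mon_apply, Matrix.one_apply]
  have : p + (((0 : Fin 4 → ZMod n) 1, (0 : Fin 4 → ZMod n) 3)) = p := add_zero p
  rw [this]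
  simp [eq_comm]

theorem mon_ne_zero (v : Fin 4 → ZMod n) : mon n v ≠ 0 := (pauliMonomial n v).ne_zero

theorem mon_comm (u v : Fin 4 → ZMod n) :
    mon n v * mon n u = e n (sform u v) • (mon n u * mon n v) := by
  rw [mon_mul, mon_mul, smul_smul, ← AddChar.map_add_eq_mul, add_comm v u, sform_eq_beta,
    sub_add_cancel]

theorem mon_conj (u v : Fin 4 → ZMod n) :
    (↑(pauliMonomial n v)⁻¹ : Matrix (ZMod n × ZMod n) (ZMod n × ZMod n) ℂ) * mon n u * mon n v
      = e n (sform v u) • mon n u := by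
  rw [Matrix.mul_assoc, mon_comm v u, Matrix.mul_smul, ← Matrix.mul_assoc, Units.inv_mul,
    Matrix.one_mul]

theorem trace_mon {v : Fin 4 → ZMod n} (hv : v ≠ 0) : Matrix.trace (mon n v) = 0 := by
  obtain ⟨w, hw⟩ := exists_sform_ne_zero hv
  have h := congrArg Matrix.trace (mon_conj v w)
  rw [Matrix.trace_mul_comm, ← Matrix.mul_assoc, Units.mul_inv, Matrix.one_mul,
    Matrix.trace_smul, smul_eq_mul] at h
  by_contra h0
  have : e n (sform w v) = 1 := mul_right_cancel₀ h0 (by rw [one_mul]; exact h.symm)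
  rw [e_eq_one_iff] at this
  exact hw (by rw [sform_swap, this, neg_zero])

theorem linearIndependent_mon : LinearIndependent ℂ (mon n) := by
  rw [Fintype.linearIndependent_iff]
  intro g hg u
  -- the trace of `X_v X_{-u}` vanishes unless `v = u`
  have h := congrArg (fun Y => Matrix.trace (Y * mon n (-u))) hg
  simp only [Finset.sum_mul, Matrix.trace_sum, Matrix.zero_mul, Matrix.trace_zero,
    Matrix.smul_mul, mon_mul, Matrix.trace_smul] at h
  rw [Finset.sum_eq_single u] at h
  · simpa [mon_zero, e_ne_zero, NeZero.ne n] using h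
  · intro v _ hv
    rw [trace_mon (by rwa [← sub_eq_add_neg, sub_ne_zero])]
    simp
  · simp

variable (n) in
/-- The Pauli monomials form a basis of the space of all matrices. -/
def monBasis : Module.Basis (Fin 4 → ZMod n) ℂ (Matrix (ZMod n × ZMod n) (ZMod n × ZMod n) ℂ) :=
  basisOfLinearIndependentOfCardEqFinrank linearIndependent_mon (by
    rw [Module.finrank_matrix]
    simp [ZMod.card]
    ring)

@[simp] theorem monBasis_apply (v : Fin 4 → ZMod n) : monBasis n v = mon n v := by
  simp [monBasis]

/-- The weight spaces of the group of all `Ad_{X_v}` are lines spanned by Pauli monomials. -/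
theorem eq_smul_mon_of_weight {Y : Matrix (ZMod n × ZMod n) (ZMod n × ZMod n) ℂ}
    {u : Fin 4 → ZMod n}
    (h : ∀ v, (↑(pauliMonomial n v)⁻¹ : Matrix (ZMod n × ZMod n) (ZMod n × ZMod n) ℂ) * Y *
      mon n v = e n (sform v u) • Y) : ∃ c : ℂ, Y = c • mon n u := by
  have hY : ∑ w, (monBasis n).repr Y w • mon n w = Y := by
    simpa using (monBasis n).sum_repr Y
  refine ⟨(monBasis n).repr Y u, ?_⟩
  have key : ∀ w, w ≠ u → (monBasis n).repr Y w = 0 := by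
    intro w hw
    by_contra h0
    refine hw (eq_of_forall_sform_eq fun v => e_injective ?_)
    have h1 : ∑ w, ((monBasis n).repr Y w * e n (sform v w)) • monBasis n w
        = e n (sform v u) • Y := by
      rw [← h v]
      nth_rw 2 [← hY]
      simp only [Matrix.mul_sum, Matrix.sum_mul, Matrix.mul_smul, Matrix.smul_mul, mon_conj,
        smul_smul, monBasis_apply]
    have h2 := congrArg (fun Z => (monBasis n).repr Z w) h1
    simp only [(monBasis n).repr_sum_self, map_smul, Finsupp.smul_apply, smul_eq_mul] at h2
    rw [mul_comm] at h2
    exact mul_right_cancel₀ h0 h2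
  nth_rw 1 [← hY]
  exact Finset.sum_eq_single u (fun w _ hw => by rw [key w hw, zero_smul]) (by simp)

end Monomials

/-! ### Extending automorphisms of `sl` to all matrices -/

section Extension

open LieAlgebra.SpecialLinear

variable {ι : Type*} [Fintype ι] [DecidableEq ι]

theorem trace_coe_sl (X : sl ι ℂ) : trace (X : Matrix ι ι ℂ) = 0 := X.2

/-- Conjugating an inner automorphism by an inner automorphism. -/
theorem Ad_mul_Ad_mul_inv (A B : GL ι ℂ) : Ad A * Ad B * (Ad A)⁻¹ = Ad (A⁻¹ * B * A) := by
  rw [Ad_inv, Ad_mul, Ad_mul, mul_assoc]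

variable [Nonempty ι]

/-- The projection of a matrix to its trace-zero part along the scalar matrices. -/
def traceless : Matrix ι ι ℂ →ₗ[ℂ] sl ι ℂ where
  toFun Y := ⟨Y - (trace Y / Fintype.card ι) • 1, by
    change trace _ = 0
    have : (Fintype.card ι : ℂ) ≠ 0 := Nat.cast_ne_zero.2 Fintype.card_ne_zero
    rw [trace_sub, trace_smul, trace_one, smul_eq_mul, div_mul_cancel₀ _ this, sub_self]⟩
  map_add' X Y := Subtype.ext (by
    change X + Y - _ = (X - _) + (Y - _)
    rw [trace_add, add_div, add_smul]; abel)
  map_smul' c X := Subtype.ext (by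
    change c • X - _ = c • (X - _)
    rw [trace_smul, smul_sub, smul_smul, smul_eq_mul, mul_div_assoc])

theorem coe_traceless (Y : Matrix ι ι ℂ) :
    ((traceless Y : sl ι ℂ) : Matrix ι ι ℂ) = Y - (trace Y / Fintype.card ι) • 1 := rfl

theorem traceless_coe (X : sl ι ℂ) : traceless (X : Matrix ι ι ℂ) = X :=
  Subtype.ext (by rw [coe_traceless, trace_coe_sl, zero_div, zero_smul, sub_zero])

theorem traceless_one : traceless (1 : Matrix ι ι ℂ) = 0 := by
  have : (Fintype.card ι : ℂ) ≠ 0 := Nat.cast_ne_zero.2 Fintype.card_ne_zero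
  refine Subtype.ext ?_
  rw [coe_traceless, trace_one, div_self this, one_smul, sub_self]
  rfl

/-- The extension of an automorphism of `sl` to a linear map of the space of all matrices which
fixes the identity matrix. -/
def hat (φ : sl ι ℂ ≃ₗ⁅ℂ⁆ sl ι ℂ) : Matrix ι ι ℂ →ₗ[ℂ] Matrix ι ι ℂ where
  toFun Y := (φ (traceless Y) : Matrix ι ι ℂ) + (trace Y / Fintype.card ι) • 1
  map_add' X Y := by
    rw [map_add, map_add, trace_add, add_div, add_smul]
    exact add_add_add_comm _ _ _ _
  map_smul' c X := by
    rw [map_smul, map_smul, trace_smul, RingHom.id_apply, smul_add, smul_smul, smul_eq_mul,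
      mul_div_assoc]
    rfl

theorem hat_apply (φ : sl ι ℂ ≃ₗ⁅ℂ⁆ sl ι ℂ) (Y : Matrix ι ι ℂ) :
    hat φ Y = (φ (traceless Y) : Matrix ι ι ℂ) + (trace Y / Fintype.card ι) • 1 := rfl

theorem hat_coe (φ : sl ι ℂ ≃ₗ⁅ℂ⁆ sl ι ℂ) (X : sl ι ℂ) :
    hat φ (X : Matrix ι ι ℂ) = (φ X : Matrix ι ι ℂ) := by
  rw [hat_apply, traceless_coe, trace_coe_sl, zero_div, zero_smul, add_zero]

theorem hat_one (φ : sl ι ℂ ≃ₗ⁅ℂ⁆ sl ι ℂ) : hat φ (1 : Matrix ι ι ℂ) = 1 := by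
  have : (Fintype.card ι : ℂ) ≠ 0 := Nat.cast_ne_zero.2 Fintype.card_ne_zero
  rw [hat_apply, traceless_one, map_zero, trace_one, div_self this, one_smul]
  exact zero_add _

theorem trace_hat (φ : sl ι ℂ ≃ₗ⁅ℂ⁆ sl ι ℂ) (Y : Matrix ι ι ℂ) :
    trace (hat φ Y) = trace Y := by
  have : (Fintype.card ι : ℂ) ≠ 0 := Nat.cast_ne_zero.2 Fintype.card_ne_zero
  rw [hat_apply, trace_add, trace_coe_sl, zero_add, trace_smul, trace_one, smul_eq_mul,
    div_mul_cancel₀ _ this]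

theorem traceless_hat (φ : sl ι ℂ ≃ₗ⁅ℂ⁆ sl ι ℂ) (Y : Matrix ι ι ℂ) :
    traceless (hat φ Y) = φ (traceless Y) := by
  rw [hat_apply, map_add, traceless_coe, map_smul, traceless_one, smul_zero, add_zero]

theorem hat_mul (φ ψ : sl ι ℂ ≃ₗ⁅ℂ⁆ sl ι ℂ) (Y : Matrix ι ι ℂ) :
    hat (φ * ψ) Y = hat φ (hat ψ Y) := by
  rw [hat_apply φ, traceless_hat, trace_hat, hat_apply]
  rfl

theorem hat_one_aut (Y : Matrix ι ι ℂ) : hat (1 : sl ι ℂ ≃ₗ⁅ℂ⁆ sl ι ℂ) Y = Y := by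
  rw [hat_apply, lieAut_one_apply, coe_traceless, sub_add_cancel]

theorem hat_injective {φ ψ : sl ι ℂ ≃ₗ⁅ℂ⁆ sl ι ℂ} (h : ∀ Y, hat φ Y = hat ψ Y) : φ = ψ :=
  LieEquiv.ext fun X => Subtype.ext (by rw [← hat_coe, ← hat_coe, h])

theorem hat_eq_zero_iff (φ : sl ι ℂ ≃ₗ⁅ℂ⁆ sl ι ℂ) {Y : Matrix ι ι ℂ} : hat φ Y = 0 ↔ Y = 0 := by
  refine ⟨fun h => ?_, fun h => by rw [h, map_zero]⟩
  rw [← hat_one_aut Y, ← inv_mul_cancel φ, hat_mul, h, map_zero]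

theorem hat_commutator (φ : sl ι ℂ ≃ₗ⁅ℂ⁆ sl ι ℂ) (X Y : Matrix ι ι ℂ) :
    hat φ (X * Y - Y * X) = hat φ X * hat φ Y - hat φ Y * hat φ X := by
  have h1 : X * Y - Y * X = ((⁅traceless X, traceless Y⁆ : sl ι ℂ) : Matrix ι ι ℂ) := by
    rw [sl_bracket, coe_traceless, coe_traceless]
    simp only [mul_sub, sub_mul, Matrix.smul_mul, Matrix.mul_smul, Matrix.one_mul, Matrix.mul_one]
    rw [smul_comm (trace X / _)]
    abel
  rw [h1, hat_coe, LieEquiv.map_lie, sl_bracket, hat_apply φ X, hat_apply φ Y]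
  simp only [mul_add, add_mul, Matrix.smul_mul, Matrix.mul_smul, Matrix.one_mul, Matrix.mul_one]
  rw [smul_comm (trace X / _)]
  abel

theorem hat_Ad (A : GL ι ℂ) (Y : Matrix ι ι ℂ) :
    hat (Ad A) Y = (↑A⁻¹ : Matrix ι ι ℂ) * Y * (A : Matrix ι ι ℂ) := by
  rw [hat_apply, coe_Ad_apply, coe_traceless, Matrix.mul_sub, Matrix.sub_mul, Matrix.mul_smul,
    Matrix.smul_mul, Matrix.mul_one, Units.inv_mul, sub_add_cancel]

theorem hat_mul_of_inner {φ : sl ι ℂ ≃ₗ⁅ℂ⁆ sl ι ℂ} (hφ : φ ∈ innerAut ι) (X Y : Matrix ι ι ℂ) :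
    hat φ (X * Y) = hat φ X * hat φ Y := by
  obtain ⟨A, rfl⟩ : ∃ A, φ = Ad A := hφ
  rw [hat_Ad, hat_Ad, hat_Ad]
  calc _ = (↑A⁻¹ : Matrix _ _ ℂ) * X * 1 * Y * (A : Matrix _ _ ℂ) := by
        simp only [Matrix.mul_assoc, Matrix.mul_one]
    _ = _ := by rw [← Units.mul_inv A]; simp only [Matrix.mul_assoc]

end Extension

/-! ### The action of the normalizer on the grading group -/

section Action

variable (n : ℕ) [NeZero n]

theorem Ad_mon_mem (v : Fin 4 → ZMod n) : Ad (pauliMonomial n v) ∈ madGroup n := by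
  refine ⟨_, (mem_pauliSet_iff n _).2 ⟨0, (v 0).val, (v 1).val, ?_⟩, _,
    (mem_pauliSet_iff n _).2 ⟨0, (v 2).val, (v 3).val, ?_⟩, rfl⟩ <;> simp

/-- The homomorphism `v ↦ Ad_{X_v}`. -/
def adMon : Multiplicative (Fin 4 → ZMod n) →* AutSl n where
  toFun v := Ad (pauliMonomial n v.toAdd)
  map_one' := by
    rw [toAdd_one, ← Ad_one]
    congr 1
    exact Units.ext mon_zero
  map_mul' u v := by
    rw [toAdd_mul, Ad_mul, add_comm]
    refine (Ad_eq_of_smul (c := e n (beta v.toAdd u.toAdd)) ?_).symm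
    rw [Units.val_mul]
    exact mon_mul _ _

variable {n}

theorem Ad_mon_add (u v : Fin 4 → ZMod n) : Ad (pauliMonomial n (u + v))
    = Ad (pauliMonomial n u) * Ad (pauliMonomial n v) :=
  (adMon n).map_mul (Multiplicative.ofAdd u) (Multiplicative.ofAdd v)

theorem gen_eq_mon (j : Fin 4) : gen n j = pauliMonomial n (Pi.single j 1) := by
  -- for `n = 1` the residue `1` has the value `0`, but then all the matrices are trivial
  by_cases h1 : n = 1
  · subst h1
    have : Subsingleton (ZMod 1 × ZMod 1) := inferInstance
    have hP : P 1 = 1 := by simpa using P_pow_n 1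
    have hQ : Q 1 = 1 := by simpa using Q_pow_n 1
    fin_cases j <;> simp [gen, pauliMonomial, hP, hQ]
  · have : Fact (1 < n) := ⟨by have := NeZero.ne n; omega⟩
    fin_cases j <;> simp [gen, pauliMonomial, ZMod.val_one]

/-- Conjugation by `φ ∈ 𝒩(𝒢)` acts on the labels of the Pauli monomials by the matrix `C(φ)`. -/
theorem conj_Ad_mon (φ : N n) (v : Fin 4 → ZMod n) :
    (φ : AutSl n) * Ad (pauliMonomial n v) * (φ : AutSl n)⁻¹
      = Ad (pauliMonomial n (C n φ *ᵥ v)) := by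
  have h : ∀ v : Fin 4 → ZMod n, ∃ w : Fin 4 → ZMod n,
      (φ : AutSl n) * Ad (pauliMonomial n v) * (φ : AutSl n)⁻¹ = Ad (pauliMonomial n w) :=
    fun v => exists_monomial n ((Subgroup.mem_normalizer_iff.1 φ.2 _).1 (Ad_mon_mem n v))
  choose f hf using h
  let F : (Fin 4 → ZMod n) →+ (Fin 4 → ZMod n) := AddMonoidHom.mk' f fun u v => by
    refine pauliMonomial_injective n ?_
    rw [Ad_mon_add, ← hf, ← hf, ← hf, Ad_mon_add]
    group
  have hFC : LinearMap.toMatrix' (F.toZModLinearMap n) = C n φ := by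
    rw [← isCoeffMatrix_iff]
    intro j
    rw [gen_eq_mon, hf]
    congr 2
  rw [hf, ← hFC, LinearMap.toMatrix'_mulVec]
  rfl

/-- A matrix which describes the conjugation action on all `Ad_{X_v}` is the coefficient matrix. -/
theorem C_eq_of_conj {φ : N n} {X : Matrix (Fin 4) (Fin 4) (ZMod n)}
    (h : ∀ v, (φ : AutSl n) * Ad (pauliMonomial n v) * (φ : AutSl n)⁻¹
      = Ad (pauliMonomial n (X *ᵥ v))) : C n φ = X := by
  refine ((isCoeffMatrix_iff n φ X).1 fun j => ?_).symm
  rw [gen_eq_mon, h]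
  congr 2
  funext i
  simp

theorem C_one : C n (1 : N n) = 1 := C_eq_of_conj fun v => by simp

theorem C_mul (φ ψ : N n) : C n (φ * ψ) = C n φ * C n ψ := C_eq_of_conj fun v => by
  rw [← Matrix.mulVec_mulVec, ← conj_Ad_mon, ← conj_Ad_mon, Subgroup.coe_mul]
  group

variable (n) in
/-- The map `φ ↦ C(φ)` as a group homomorphism to the invertible matrices. -/
def CHom : N n →* GL (Fin 4) (ZMod n) :=
  MonoidHom.toHomUnits { toFun := C n, map_one' := C_one, map_mul' := C_mul }

/-- An automorphism `φ ∈ 𝒩(𝒢)` permutes the lines spanned by the Pauli monomials: it maps `X_u` to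
a multiple `c_u X_{Du}`, where `D` is the matrix contragredient to `C(φ)` for the form `J`. -/
theorem exists_weights (φ : N n) : ∃ (D : Matrix (Fin 4) (Fin 4) (ZMod n))
    (c : (Fin 4 → ZMod n) → ℂ), (∀ u v, sform (C n φ *ᵥ v) (D *ᵥ u) = sform v u) ∧
      c 0 = 1 ∧ (∀ u, c u ≠ 0) ∧
      ∀ u, hat (φ : AutSl n) (mon n u) = c u • mon n (D *ᵥ u) := by
  set C' : Matrix (Fin 4) (Fin 4) (ZMod n) := C n φ⁻¹ with hC'
  have hCC : C' * C n φ = 1 := by rw [hC', ← C_mul, inv_mul_cancel, C_one]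
  have hJJ : J n * J n = -1 := by
    ext i j
    fin_cases i <;> fin_cases j <;> simp [J, Matrix.mul_apply, Fin.sum_univ_four]
  have hD : ∀ u v, sform (C n φ *ᵥ v) ((-(J n * C'ᵀ * J n)) *ᵥ u) = sform v u := by
    intro u v
    rw [sform_eq_dotProduct, sform_eq_dotProduct, Matrix.mulVec_mulVec]
    have : J n * -(J n * C'ᵀ * J n) = C'ᵀ * J n := by
      rw [Matrix.mul_neg, ← Matrix.mul_assoc, ← Matrix.mul_assoc, hJJ]
      simp
    rw [this, ← Matrix.mulVec_mulVec, Matrix.dotProduct_mulVec, Matrix.vecMul_transpose,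
      Matrix.mulVec_mulVec, hCC, Matrix.one_mulVec]
  have hw : ∀ u, ∃ c : ℂ,
      hat (φ : AutSl n) (mon n u) = c • mon n ((-(J n * C'ᵀ * J n)) *ᵥ u) := by
    intro u
    refine eq_smul_mon_of_weight fun w => ?_
    have hw' : w = C n φ *ᵥ (C' *ᵥ w) := by
      rw [Matrix.mulVec_mulVec, mul_eq_one_comm.1 hCC, Matrix.one_mulVec]
    rw [← hat_Ad, hw', ← conj_Ad_mon, ← hat_mul, inv_mul_cancel_right, hat_mul, hat_Ad, mon_conj,
      map_smul, hD]
  choose c hc using hw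
  refine ⟨_, c, hD, ?_, fun u h0 => ?_, hc⟩
  · have := hc 0
    rw [Matrix.mulVec_zero, mon_zero, hat_one] at this
    have h1 := congrFun (congrFun this 0) 0
    simpa using h1.symm
  · have := hc u
    rw [h0, zero_smul, hat_eq_zero_iff] at this
    exact mon_ne_zero u this

end Action

/-! ### The multiplier of a normalizing automorphism is `± 1` -/

section Multiplier

variable {n : ℕ}

/-- A linear map which preserves orthogonality for the symplectic form is a similitude. -/
theorem exists_multiplier {D : Matrix (Fin 4) (Fin 4) (ZMod n)}
    (h : ∀ u v, sform u v = 0 → sform (D *ᵥ u) (D *ᵥ v) = 0) :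
    ∃ k : ZMod n, ∀ u v, sform (D *ᵥ u) (D *ᵥ v) = k * sform u v := by
  set E : Fin 4 → Fin 4 → ZMod n := fun i => Pi.single i 1 with hE
  have dec : ∀ u : Fin 4 → ZMod n, u = u 0 • E 0 + u 1 • E 1 + u 2 • E 2 + u 3 • E 3 := by
    intro u
    funext i
    fin_cases i <;> simp [hE]
  have h02 := h (E 0) (E 2) (by simp [sform, hE])
  have h03 := h (E 0) (E 3) (by simp [sform, hE])
  have h12 := h (E 1) (E 2) (by simp [sform, hE])
  have h13 := h (E 1) (E 3) (by simp [sform, hE])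
  -- the orthogonality of `e₀ + e₂` and `e₁ - e₃` compares the multipliers on the two planes
  have hs := h (E 0 + E 2) (E 1 + -1 • E 3) (by simp [sform, hE])
  simp only [Matrix.mulVec_add, sform_add_left, sform_add_right, neg_smul, one_smul,
    Matrix.mulVec_neg] at hs
  have hneg : ∀ u v : Fin 4 → ZMod n, sform u (-v) = -sform u v := by
    intro u v
    simp only [sform, Pi.neg_apply]; ring
  simp only [hneg] at hs
  refine ⟨sform (D *ᵥ E 0) (D *ᵥ E 1), fun u v => ?_⟩
  have e1 : sform (D *ᵥ u) (D *ᵥ v) = sform (D *ᵥ (u 0 • E 0 + u 1 • E 1 + u 2 • E 2 + u 3 • E 3))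
      (D *ᵥ (v 0 • E 0 + v 1 • E 1 + v 2 • E 2 + v 3 • E 3)) := by rw [← dec u, ← dec v]
  rw [e1]
  simp only [Matrix.mulVec_add, Matrix.mulVec_smul, sform_add_left, sform_add_right,
    sform_smul_left, sform_smul_right, sform_self]
  rw [sform_swap (D *ᵥ E 1) (D *ᵥ E 0), sform_swap (D *ᵥ E 2) (D *ᵥ E 0),
    sform_swap (D *ᵥ E 3) (D *ᵥ E 0), sform_swap (D *ᵥ E 2) (D *ᵥ E 1),
    sform_swap (D *ᵥ E 3) (D *ᵥ E 1), sform_swap (D *ᵥ E 3) (D *ᵥ E 2)]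
  rw [show sform u v = u 0 * v 1 - u 1 * v 0 + u 2 * v 3 - u 3 * v 2 from rfl]
  linear_combination (u 0 * v 2 - u 2 * v 0) * h02 + (u 0 * v 3 - u 3 * v 0) * h03
    + (u 1 * v 2 - u 2 * v 1) * h12 + (u 1 * v 3 - u 3 * v 1) * h13
    + (u 3 * v 2 - u 2 * v 3) * (hs - sform_swap (D *ᵥ E 2) (D *ᵥ E 1) + h03 + h12)

variable [NeZero n]

/-- Comparing the images of `[X_u, X_v]` under an automorphism which permutes the lines spanned by
the Pauli monomials. -/
theorem weights_commutator {φ : AutSl n} {D : Matrix (Fin 4) (Fin 4) (ZMod n)}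
    {c : (Fin 4 → ZMod n) → ℂ} (hc : ∀ u, hat φ (mon n u) = c u • mon n (D *ᵥ u))
    (u v : Fin 4 → ZMod n) :
    c u * c v * (1 - e n (sform (D *ᵥ u) (D *ᵥ v))) * e n (beta (D *ᵥ u) (D *ᵥ v))
      = c (u + v) * (1 - e n (sform u v)) * e n (beta u v) := by
  have comm : ∀ u v : Fin 4 → ZMod n, mon n u * mon n v - mon n v * mon n u
      = ((1 - e n (sform u v)) * e n (beta u v)) • mon n (u + v) := by
    intro u v
    rw [mon_comm u v, mon_mul, smul_smul, ← sub_smul, sub_mul, one_mul]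
  have h := hat_commutator φ (mon n u) (mon n v)
  rw [comm, map_smul, hc, hc, hc] at h
  simp only [Matrix.smul_mul, Matrix.mul_smul, smul_smul] at h
  rw [mul_comm (c v) (c u), ← smul_sub, comm, smul_smul, Matrix.mulVec_add] at h
  have h' := smul_left_injective ℂ (mon_ne_zero _) h
  linear_combination -h'

end Multiplier

section Prime

variable {n : ℕ} [Fact n.Prime]

theorem eq_or_eq_neg_of_norm_one_sub_e {a b : ZMod n} (h : ‖1 - e n a‖ = ‖1 - e n b‖) :
    a = b ∨ a = -b := by
  have hre : ∀ z : ℂ, ‖z‖ = 1 → ‖1 - z‖ ^ 2 = 2 - 2 * z.re ∧ z.re ^ 2 + z.im ^ 2 = 1 := by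
    intro z hz
    have h1 : z.re ^ 2 + z.im ^ 2 = 1 := by
      have := Complex.sq_norm z
      rw [hz, Complex.normSq_apply] at this
      linarith
    refine ⟨?_, h1⟩
    rw [Complex.sq_norm, Complex.normSq_apply]
    simp
    linarith
  obtain ⟨ha, ha'⟩ := hre _ (norm_e a)
  obtain ⟨hb, hb'⟩ := hre _ (norm_e b)
  rw [h, hb] at ha
  have hr : (e n a).re = (e n b).re := by linarith
  rw [hr] at ha'
  have him : (e n a).im = (e n b).im ∨ (e n a).im = -(e n b).im := sq_eq_sq_iff_eq_or_eq_neg.1 (by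
    linarith)
  rcases him with him | him
  · exact Or.inl (e_injective (Complex.ext hr him))
  · refine Or.inr (e_injective ?_)
    rw [AddChar.map_neg_eq_conj]
    exact Complex.ext hr him

theorem one_sub_e_ne_zero {a : ZMod n} (ha : a ≠ 0) : 1 - e n a ≠ 0 :=
  sub_ne_zero.2 fun h => ha (e_eq_one_iff.1 h.symm)

/-- The multiplier of the permutation of the Pauli monomials induced by an automorphism is `± 1`.
With `p = ‖c_u‖` one has `‖c_u‖ ‖c_{v + ju}‖ ‖1 - ω^{ks}‖ = ‖c_{v + (j + 1)u}‖ ‖1 - ω^s‖` for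
`s = uᵀ J v`. The product over all `j` gives `p ‖1 - ω^{ks}‖ = ‖1 - ω^s‖`, and the product of these
over all `s ≠ 0` gives `p = 1`. -/
theorem multiplier_eq {φ : AutSl n} {D : Matrix (Fin 4) (Fin 4) (ZMod n)}
    {c : (Fin 4 → ZMod n) → ℂ} (hc0 : ∀ u, c u ≠ 0)
    (hc : ∀ u, hat φ (mon n u) = c u • mon n (D *ᵥ u)) :
    ∃ k : ZMod n, (k = 1 ∨ k = -1) ∧ ∀ u v, sform (D *ᵥ u) (D *ᵥ v) = k * sform u v := by
  have hrel := weights_commutator hc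
  obtain ⟨k, hk⟩ := exists_multiplier (D := D) fun u v h => by
    have h1 := hrel u v
    rw [h, AddChar.map_zero_eq_one, sub_self, mul_zero, zero_mul, mul_eq_zero, mul_eq_zero,
      mul_eq_zero] at h1
    rcases h1 with ((h1 | h1) | h1) | h1
    · exact absurd h1 (hc0 _)
    · exact absurd h1 (hc0 _)
    · exact e_eq_one_iff.1 (sub_eq_zero.1 h1).symm
    · exact absurd h1 (e_ne_zero _)
  refine ⟨k, ?_, hk⟩
  have hnorm : ∀ u v, ‖c u‖ * ‖c v‖ * ‖1 - e n (k * sform u v)‖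
      = ‖c (u + v)‖ * ‖1 - e n (sform u v)‖ := by
    intro u v
    have h1 := congrArg norm (hrel u v)
    simpa only [norm_mul, norm_e, mul_one, hk] using h1
  set u : Fin 4 → ZMod n := Pi.single 0 1 with hu
  have hstep : ∀ s : ZMod n, ‖c u‖ * ‖1 - e n (k * s)‖ = ‖1 - e n s‖ := by
    intro s
    set v : Fin 4 → ZMod n := Pi.single 1 s with hv
    have huv : ∀ j : ZMod n, sform u (v + j • u) = s := by
      intro j
      rw [sform_add_right, sform_smul_right, sform_self, mul_zero, add_zero]
      simp [sform, hu, hv]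
    have hj : ∀ j : ZMod n, (‖c u‖ * ‖1 - e n (k * s)‖) * ‖c (v + j • u)‖
        = ‖1 - e n s‖ * ‖c (v + (j + 1) • u)‖ := by
      intro j
      have h1 := hnorm u (v + j • u)
      rw [huv] at h1
      have h2 : u + (v + j • u) = v + (j + 1) • u := by rw [add_smul, one_smul]; abel
      rw [h2] at h1
      linarith
    have hprod := Finset.prod_congr (rfl : (Finset.univ : Finset (ZMod n)) = _) fun j _ => hj j
    have hshift : ∏ j : ZMod n, ‖c (v + (j + 1) • u)‖ = ∏ j : ZMod n, ‖c (v + j • u)‖ :=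
      Equiv.prod_comp (Equiv.addRight (1 : ZMod n)) fun j => ‖c (v + j • u)‖
    simp only [Finset.prod_mul_distrib, Finset.prod_const, ← mul_pow, hshift] at hprod
    have hne : ∏ j : ZMod n, ‖c (v + j • u)‖ ≠ 0 :=
      Finset.prod_ne_zero_iff.2 fun j _ => norm_ne_zero_iff.2 (hc0 _)
    exact (pow_left_inj₀ (by positivity) (by positivity)
      (Finset.card_ne_zero_of_mem (Finset.mem_univ 0))).1
      (mul_right_cancel₀ hne hprod)
  have hk0 : k ≠ 0 := by
    rintro rfl
    have h1 := hstep 1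
    rw [zero_mul, AddChar.map_zero_eq_one, sub_self, norm_zero, mul_zero] at h1
    exact one_sub_e_ne_zero one_ne_zero (norm_eq_zero.1 h1.symm)
  have hcu : ‖c u‖ = 1 := by
    have hprod := Finset.prod_congr (rfl : (Finset.univ : Finset (ZMod n)ˣ) = _)
      fun s _ => hstep (s : ZMod n)
    rw [Finset.prod_mul_distrib, Finset.prod_const] at hprod
    have h1 := Equiv.prod_comp (Equiv.mulLeft (Units.mk0 k hk0))
      fun s : (ZMod n)ˣ => ‖1 - e n (s : ZMod n)‖
    simp only [Equiv.coe_mulLeft, Units.val_mul, Units.val_mk0] at h1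
    rw [h1] at hprod
    have hne : ∏ s : (ZMod n)ˣ, ‖1 - e n (s : ZMod n)‖ ≠ 0 :=
      Finset.prod_ne_zero_iff.2 fun s _ => norm_ne_zero_iff.2 (one_sub_e_ne_zero s.ne_zero)
    have h2 : ‖c u‖ ^ _ = 1 := mul_right_cancel₀ hne (by rw [one_mul]; exact hprod)
    exact (pow_eq_one_iff_of_nonneg (norm_nonneg _)
      (Finset.card_ne_zero_of_mem (Finset.mem_univ 1))).1 h2
  have h1 := hstep 1
  rw [hcu, one_mul, mul_one] at h1
  exact eq_or_eq_neg_of_norm_one_sub_e h1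

theorem sform_one_eq (i j : Fin 4) (X : Matrix (Fin 4) (Fin 4) (ZMod n)) :
    sform (X *ᵥ Pi.single i 1) (X *ᵥ Pi.single j 1) = (Xᵀ * J n * X) i j := by
  rw [sform_eq_dotProduct, Matrix.mulVec_mulVec, Matrix.mulVec_single_one,
    Matrix.mulVec_single_one, Matrix.mul_assoc]
  rfl

/-- A matrix is a symplectic similitude with multiplier `k` iff `Xᵀ J X = k J`. -/
theorem conj_J_eq_smul_iff {X : Matrix (Fin 4) (Fin 4) (ZMod n)} {k : ZMod n} :
    Xᵀ * J n * X = k • J n ↔ ∀ u v, sform (X *ᵥ u) (X *ᵥ v) = k * sform u v := by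
  have hJ : ∀ i j, sform (Pi.single i 1) (Pi.single j 1) = J n i j := by
    intro i j
    have := sform_one_eq (n := n) i j 1
    rwa [Matrix.one_mulVec, Matrix.one_mulVec, Matrix.transpose_one, Matrix.one_mul,
      Matrix.mul_one] at this
  refine ⟨fun h u v => ?_, fun h => ?_⟩
  · rw [sform_eq_dotProduct, sform_eq_dotProduct, Matrix.mulVec_mulVec, ← Matrix.vecMul_transpose,
      ← Matrix.dotProduct_mulVec, Matrix.mulVec_mulVec, ← Matrix.mul_assoc, h, Matrix.smul_mulVec,
      dotProduct_smul, smul_eq_mul]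
  · ext i j
    rw [← sform_one_eq, h, hJ, Matrix.smul_apply, smul_eq_mul]

/-- If `D` is contragredient to `X` and a similitude with multiplier `k = ± 1`, then so is `X`. -/
theorem conj_J_of_contragredient {X D : Matrix (Fin 4) (Fin 4) (ZMod n)} {k : ZMod n}
    (hXD : ∀ u v, sform (X *ᵥ v) (D *ᵥ u) = sform v u) (hk : k = 1 ∨ k = -1)
    (hD : ∀ u v, sform (D *ᵥ u) (D *ᵥ v) = k * sform u v) : Xᵀ * J n * X = k • J n := by
  have hkk : k * k = 1 := by rcases hk with rfl | rfl <;> ring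
  have hX : IsUnit D := isUnit_of_conj n (by
    rw [conj_J_eq_smul_iff.2 hD]
    rcases hk with rfl | rfl <;> simp)
  have hDX : ∀ v, X *ᵥ v = k • (D *ᵥ v) := by
    intro v
    refine eq_of_forall_sform_eq fun w => ?_
    obtain ⟨Y, hY⟩ := hX.exists_right_inv
    have hw : w = D *ᵥ (Y *ᵥ w) := by rw [Matrix.mulVec_mulVec, hY, Matrix.one_mulVec]
    rw [hw, sform_swap, hXD, sform_smul_right, hD, ← mul_assoc, hkk, one_mul, ← sform_swap]
  rw [conj_J_eq_smul_iff]
  intro u v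
  rw [hDX, hDX, sform_smul_left, sform_smul_right, hD, ← mul_assoc, hkk, one_mul]

theorem conj_J_C (φ : N n) : (C n φ)ᵀ * J n * C n φ = J n ∨ (C n φ)ᵀ * J n * C n φ = -J n := by
  obtain ⟨D, c, hD, -, hc0, hc⟩ := exists_weights φ
  obtain ⟨k, hk, hDk⟩ := multiplier_eq hc0 hc
  have h := conj_J_of_contragredient hD hk hDk
  rcases hk with rfl | rfl
  · exact Or.inl (by rw [h, one_smul])
  · exact Or.inr (by rw [h, neg_smul, one_smul])

/-- An inner automorphism is multiplicative, so that it preserves the commutation relations of the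
Pauli monomials and not only their vanishing. -/
theorem conj_J_C_of_inner {φ : N n} (hφ : φ ∈ Nin n) : (C n φ)ᵀ * J n * C n φ = J n := by
  obtain ⟨D, c, hD, -, hc0, hc⟩ := exists_weights φ
  have h := conj_J_of_contragredient hD (Or.inl rfl) fun u v => ?_
  · rw [h, one_smul]
  · rw [one_mul]
    have h1 := congrArg (hat (φ : AutSl n)) (mon_comm u v)
    rw [map_smul, hat_mul_of_inner (φ := (φ : AutSl n)) hφ,
      hat_mul_of_inner (φ := (φ : AutSl n)) hφ, hc, hc] at h1
    simp only [Matrix.smul_mul, Matrix.mul_smul, smul_smul] at h1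
    rw [mon_comm (D *ᵥ u), mon_mul, smul_smul, smul_smul, smul_smul] at h1
    have h2 := smul_left_injective ℂ (mon_ne_zero _) h1
    have hne : c u * c v * e n (beta (D *ᵥ u) (D *ᵥ v)) ≠ 0 :=
      mul_ne_zero (mul_ne_zero (hc0 _) (hc0 _)) (e_ne_zero _)
    refine e_injective (mul_right_cancel₀ hne ?_)
    linear_combination h2

end Prime

/-! ### Realizing symplectic matrices by inner automorphisms -/

section SkolemNoether

/-- The Skolem–Noether theorem for full matrix algebras: every automorphism is a conjugation. -/
theorem exists_conj_of_algEquiv {ι K : Type*} [Fintype ι] [DecidableEq ι] [Field K]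
    (f : Matrix ι ι K ≃ₐ[K] Matrix ι ι K) : ∃ A : GL ι K,
    ∀ Y, f Y = (A : Matrix ι ι K) * Y * (↑A⁻¹ : Matrix ι ι K) := by
  obtain ⟨T, hT⟩ := AlgEquiv.eq_linearEquivConjAlgEquiv
    ((Matrix.toLinAlgEquiv'.symm.trans f).trans Matrix.toLinAlgEquiv')
  have h1 : LinearMap.toMatrix' T.toLinearMap * LinearMap.toMatrix' T.symm.toLinearMap = 1 := by
    rw [← LinearMap.toMatrix'_comp]; simp
  have h2 : LinearMap.toMatrix' T.symm.toLinearMap * LinearMap.toMatrix' T.toLinearMap = 1 := by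
    rw [← LinearMap.toMatrix'_comp]; simp
  refine ⟨⟨_, _, h1, h2⟩, fun Y => ?_⟩
  have h3 := congrArg LinearMap.toMatrix' (AlgEquiv.congr_fun hT (Matrix.toLinAlgEquiv' Y))
  rw [LinearEquiv.conjAlgEquiv_apply, LinearMap.toMatrix'_comp, LinearMap.toMatrix'_comp,
    ← mul_assoc] at h3
  have h4 : ∀ Z : Matrix ι ι K, LinearMap.toMatrix' (Matrix.toLinAlgEquiv' Z) = Z :=
    LinearMap.toMatrix'_toLin'
  simp only [AlgEquiv.trans_apply, AlgEquiv.symm_apply_apply, h4] at h3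
  exact h3

end SkolemNoether

section Realization

variable {n : ℕ}

/-- The matrix of the form `β`. -/
def betaMatrix : Matrix (Fin 4) (Fin 4) (ZMod n) :=
  !![0, 0, 0, 0; 1, 0, 0, 0; 0, 0, 0, 0; 0, 0, 1, 0]

theorem beta_eq_dotProduct (u v : Fin 4 → ZMod n) : beta u v = u ⬝ᵥ (betaMatrix *ᵥ v) := by
  simp [beta, betaMatrix, dotProduct, mulVec, Fin.sum_univ_four]

theorem betaMatrix_transpose : (betaMatrix : Matrix (Fin 4) (Fin 4) (ZMod n))ᵀ
    = betaMatrix + J n := by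
  ext i j
  fin_cases i <;> fin_cases j <;> simp [betaMatrix, J]

variable [NeZero n]

/-- A quadratic refinement of the pairing `(a, b) ↦ ω ^ (a b)` on `ℤ/n`, for even `n` as well:
`s(a) = ζ ^ (a (a + n))` with `ζ = e^{πi/n}` depends only on `a` modulo `n`. -/
theorem exists_quadratic_refinement : ∃ s : ZMod n → ℂ, (∀ a, s a ≠ 0) ∧
    ∀ a b, s (a + b) = e n (a * b) * (s a * s b) := by
  set ζ : ℂ := Complex.exp (Real.pi * Complex.I / n) with hζ
  have hζ0 : ζ ≠ 0 := Complex.exp_ne_zero _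
  have hζ2 : ∀ k : ℤ, ζ ^ (2 * k) = e n (k : ZMod n) := by
    intro k
    rw [ZMod.stdAddChar_coe, hζ, ← Complex.exp_int_mul]
    congr 1
    push_cast
    ring
  set f : ℤ → ℂ := fun x => ζ ^ (x * (x + n)) with hf
  have hadd : ∀ x y, f (x + y) = e n ((x : ZMod n) * y) * (f x * f y) := by
    intro x y
    have := hζ2 (x * y)
    push_cast at this
    rw [hf, ← this]
    simp only [← zpow_add₀ hζ0]
    congr 1
    ring
  have hper : ∀ x k : ℤ, f (x + n * k) = f x := by
    intro x k
    have h1 : f (n * k) = 1 := by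
      rw [hf]
      have h2 : (n * k : ℤ) * (n * k + n) = 2 * (n * (n * (k * (k + 1) / 2))) := by
        have := Int.ediv_mul_cancel (Int.even_mul_succ_self k).two_dvd
        linear_combination (-(n : ℤ) ^ 2) * this
      simp only [h2, hζ2]
      simp
    rw [hadd, h1]
    simp
  refine ⟨fun a => f a.val, fun a => zpow_ne_zero _ hζ0, fun a b => ?_⟩
  have h1 := hadd a.val b.val
  rw [Int.cast_natCast, Int.cast_natCast, ZMod.natCast_zmod_val, ZMod.natCast_zmod_val] at h1
  obtain ⟨k, hk⟩ : ∃ k : ℤ, ((a + b).val : ℤ) = (a.val + b.val : ℤ) + n * k := by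
    have h2 : (((a.val + b.val : ℤ)) : ZMod n) = (((a + b).val : ℤ) : ZMod n) := by simp
    obtain ⟨k, hk⟩ := (ZMod.intCast_eq_intCast_iff_dvd_sub _ _ _).1 h2
    exact ⟨k, by linarith⟩
  simp only [hk, hper, h1]

/-- A symmetric bilinear form on `(ℤ/n)⁴` is, as a `2`-cocycle with values in `ℂˣ`, a
coboundary. -/
theorem exists_coboundary {g : Matrix (Fin 4) (Fin 4) (ZMod n)} (hg : gᵀ = g) :
    ∃ d : (Fin 4 → ZMod n) → ℂ, (∀ v, d v ≠ 0) ∧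
      ∀ u v, d (u + v) = e n (u ⬝ᵥ (g *ᵥ v)) * (d u * d v) := by
  obtain ⟨s, hs0, hs⟩ := exists_quadratic_refinement (n := n)
  have hs' : ∀ i (a b : ZMod n), s (a + b) ^ (g i i).val
      = e n (g i i * (a * b)) * (s a ^ (g i i).val * s b ^ (g i i).val) := by
    intro i a b
    rw [hs, mul_pow, mul_pow, ← AddChar.map_nsmul_eq_pow, nsmul_eq_mul]
    simp
  refine ⟨fun v => (∏ i, s (v i) ^ (g i i).val) * e n (g 0 1 * (v 0 * v 1) + g 0 2 * (v 0 * v 2)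
    + g 0 3 * (v 0 * v 3) + g 1 2 * (v 1 * v 2) + g 1 3 * (v 1 * v 3) + g 2 3 * (v 2 * v 3)),
    fun v => mul_ne_zero (Finset.prod_ne_zero_iff.2 fun i _ => pow_ne_zero _ (hs0 _))
      (e_ne_zero _), fun u v => ?_⟩
  have hsymm : ∀ i j, g j i = g i j := fun i j => congrFun (congrFun hg i) j
  have key : e n (g 0 0 * (u 0 * v 0)) * e n (g 1 1 * (u 1 * v 1)) * e n (g 2 2 * (u 2 * v 2))
      * e n (g 3 3 * (u 3 * v 3)) * e n (g 0 1 * ((u 0 + v 0) * (u 1 + v 1))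
        + g 0 2 * ((u 0 + v 0) * (u 2 + v 2)) + g 0 3 * ((u 0 + v 0) * (u 3 + v 3))
        + g 1 2 * ((u 1 + v 1) * (u 2 + v 2)) + g 1 3 * ((u 1 + v 1) * (u 3 + v 3))
        + g 2 3 * ((u 2 + v 2) * (u 3 + v 3)))
      = e n (u ⬝ᵥ (g *ᵥ v)) * (e n (g 0 1 * (u 0 * u 1) + g 0 2 * (u 0 * u 2)
        + g 0 3 * (u 0 * u 3) + g 1 2 * (u 1 * u 2) + g 1 3 * (u 1 * u 3) + g 2 3 * (u 2 * u 3))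
      * e n (g 0 1 * (v 0 * v 1) + g 0 2 * (v 0 * v 2)
        + g 0 3 * (v 0 * v 3) + g 1 2 * (v 1 * v 2) + g 1 3 * (v 1 * v 3)
        + g 2 3 * (v 2 * v 3))) := by
    simp only [← AddChar.map_add_eq_mul]
    congr 1
    simp only [dotProduct, mulVec, Fin.sum_univ_four]
    rw [hsymm 0 1, hsymm 0 2, hsymm 0 3, hsymm 1 2, hsymm 1 3, hsymm 2 3]
    ring
  simp only [Fin.prod_univ_four, Pi.add_apply, hs']
  linear_combination (s (u 0) ^ (g 0 0).val * s (v 0) ^ (g 0 0).val *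
    (s (u 1) ^ (g 1 1).val * s (v 1) ^ (g 1 1).val) *
    (s (u 2) ^ (g 2 2).val * s (v 2) ^ (g 2 2).val) *
    (s (u 3) ^ (g 3 3).val * s (v 3) ^ (g 3 3).val)) * key

/-- The permutation of the Pauli monomials by a symplectic matrix, with suitable scalar factors, is
an automorphism of the algebra of all matrices, hence a conjugation. -/
theorem exists_conj_mon {X : Matrix (Fin 4) (Fin 4) (ZMod n)} (hX : Xᵀ * J n * X = J n) :
    ∃ (A : GL (ZMod n × ZMod n) ℂ) (d : (Fin 4 → ZMod n) → ℂ), ∀ v,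
      (A : Matrix (ZMod n × ZMod n) (ZMod n × ZMod n) ℂ) * mon n v *
        (↑A⁻¹ : Matrix (ZMod n × ZMod n) (ZMod n × ZMod n) ℂ) = d v • mon n (X *ᵥ v) := by
  obtain ⟨d, hd0, hd⟩ := exists_coboundary (g := Xᵀ * betaMatrix * X - betaMatrix) (by
    rw [Matrix.transpose_sub, Matrix.transpose_mul, Matrix.transpose_mul,
      Matrix.transpose_transpose, betaMatrix_transpose, Matrix.add_mul, Matrix.mul_add,
      ← Matrix.mul_assoc, ← Matrix.mul_assoc, hX, add_sub_add_right_eq_sub])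
  have hd' : ∀ u v, d u * d v * e n (beta (X *ᵥ u) (X *ᵥ v)) = e n (beta u v) * d (u + v) := by
    intro u v
    have h1 : u ⬝ᵥ ((Xᵀ * betaMatrix * X - betaMatrix) *ᵥ v)
        = beta (X *ᵥ u) (X *ᵥ v) - beta u v := by
      rw [beta_eq_dotProduct, beta_eq_dotProduct, Matrix.sub_mulVec, dotProduct_sub,
        Matrix.mulVec_mulVec, ← Matrix.vecMul_transpose X u, ← Matrix.dotProduct_mulVec,
        Matrix.mulVec_mulVec, Matrix.mul_assoc]
    rw [hd, h1, ← mul_assoc, ← AddChar.map_add_eq_mul, add_sub_cancel, mul_comm]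
  have hd1 : d 0 = 1 := by
    have h1 := hd' 0 0
    rw [Matrix.mulVec_zero, add_zero, mul_comm] at h1
    have h2 := mul_left_cancel₀ (e_ne_zero _) h1
    exact mul_right_cancel₀ (hd0 0) (by rw [h2, one_mul])
  set f : Matrix (ZMod n × ZMod n) (ZMod n × ZMod n) ℂ →ₗ[ℂ]
      Matrix (ZMod n × ZMod n) (ZMod n × ZMod n) ℂ :=
    (monBasis n).constr ℂ fun v => d v • mon n (X *ᵥ v) with hf
  have hfm : ∀ v, f (mon n v) = d v • mon n (X *ᵥ v) := by
    intro v
    rw [← monBasis_apply, hf, Module.Basis.constr_basis]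
  have hone : f 1 = 1 := by
    rw [← mon_zero, hfm, hd1, one_smul, Matrix.mulVec_zero]
  have hmul : ∀ Y Z, f (Y * Z) = f Y * f Z := by
    rw [LinearMap.map_mul_iff]
    refine (monBasis n).ext fun u => (monBasis n).ext fun v => ?_
    change f (monBasis n u * monBasis n v) = f (monBasis n u) * f (monBasis n v)
    simp only [monBasis_apply, hfm, mon_mul, map_smul, Matrix.smul_mul, Matrix.mul_smul,
      smul_smul, Matrix.mulVec_add, ← hd']
    congr 1
    ring
  set F : Matrix (ZMod n × ZMod n) (ZMod n × ZMod n) ℂ →ₐ[ℂ]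
      Matrix (ZMod n × ZMod n) (ZMod n × ZMod n) ℂ := AlgHom.ofLinearMap f hone hmul with hF
  have hinj : Function.Injective F := F.toRingHom.injective
  have hsurj : Function.Surjective F := LinearMap.injective_iff_surjective.1
    (show Function.Injective F.toLinearMap from hinj)
  obtain ⟨A, hA⟩ := exists_conj_of_algEquiv (AlgEquiv.ofBijective F ⟨hinj, hsurj⟩)
  exact ⟨A, d, fun v => by rw [← hA, ← hfm]; rfl⟩

/-- An automorphism which permutes the `Ad_{X_v}` through an invertible matrix normalizes `𝒢`. -/
theorem mem_N_of_conj {φ : AutSl n} {X Y : Matrix (Fin 4) (Fin 4) (ZMod n)} (hXY : X * Y = 1)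
    (h : ∀ v, φ * Ad (pauliMonomial n v) * φ⁻¹ = Ad (pauliMonomial n (X *ᵥ v))) : φ ∈ N n := by
  rw [Subgroup.mem_normalizer_iff]
  intro ψ
  refine ⟨fun hψ => ?_, fun hψ => ?_⟩
  · obtain ⟨v, rfl⟩ := exists_monomial n hψ
    rw [h]
    exact Ad_mon_mem n _
  · obtain ⟨v, hv⟩ := exists_monomial n hψ
    have h1 := h (Y *ᵥ v)
    rw [Matrix.mulVec_mulVec, hXY, Matrix.one_mulVec, ← hv] at h1
    have h2 : Ad (pauliMonomial n (Y *ᵥ v)) = ψ := mul_left_cancel (mul_right_cancel h1)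
    rw [← h2]
    exact Ad_mon_mem n _

theorem exists_inner_of_conj_J {X : Matrix (Fin 4) (Fin 4) (ZMod n)} (hX : Xᵀ * J n * X = J n) :
    ∃ φ : N n, φ ∈ Nin n ∧ C n φ = X := by
  obtain ⟨A, d, hA⟩ := exists_conj_mon hX
  have h : ∀ v, Ad A⁻¹ * Ad (pauliMonomial n v) * (Ad A⁻¹)⁻¹
      = Ad (pauliMonomial n (X *ᵥ v)) := by
    intro v
    rw [Ad_mul_Ad_mul_inv, inv_inv]
    exact Ad_eq_of_smul (hA v)
  obtain ⟨Y, hY⟩ := (isUnit_of_conj n (Or.inl hX)).exists_right_inv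
  exact ⟨⟨Ad A⁻¹, mem_N_of_conj hY h⟩, ⟨A⁻¹, rfl⟩, C_eq_of_conj h⟩

end Realization

/-! ### The outer automorphism `X ↦ -Xᵀ` -/

section Outer

variable {ι : Type*} [Fintype ι] [DecidableEq ι]

variable (ι) in
/-- The automorphism `X ↦ -Xᵀ` of the trace-zero matrices. -/
def negTranspose : LieAlgebra.SpecialLinear.sl ι ℂ ≃ₗ⁅ℂ⁆ LieAlgebra.SpecialLinear.sl ι ℂ where
  toFun X := ⟨-X.1ᵀ, by
    have h : Matrix.trace X.1 = 0 := X.2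
    change Matrix.trace _ = 0
    rw [Matrix.trace_neg, Matrix.trace_transpose, h, neg_zero]⟩
  invFun X := ⟨-X.1ᵀ, by
    have h : Matrix.trace X.1 = 0 := X.2
    change Matrix.trace _ = 0
    rw [Matrix.trace_neg, Matrix.trace_transpose, h, neg_zero]⟩
  map_add' X Y := Subtype.ext (by
    change -(X.1 + Y.1)ᵀ = -X.1ᵀ + -Y.1ᵀ
    rw [Matrix.transpose_add, neg_add])
  map_smul' c X := Subtype.ext (by
    change -(c • X.1)ᵀ = c • -X.1ᵀ
    rw [Matrix.transpose_smul, smul_neg])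
  map_lie' := by
    intro X Y
    apply Subtype.ext
    change -(X.1 * Y.1 - Y.1 * X.1)ᵀ = -X.1ᵀ * -Y.1ᵀ - -Y.1ᵀ * -X.1ᵀ
    rw [Matrix.transpose_sub, Matrix.transpose_mul, Matrix.transpose_mul, neg_mul_neg, neg_mul_neg,
      neg_sub]
  left_inv X := Subtype.ext (by
    change -(-X.1ᵀ)ᵀ = X.1
    rw [Matrix.transpose_neg, Matrix.transpose_transpose, neg_neg])
  right_inv X := Subtype.ext (by
    change -(-X.1ᵀ)ᵀ = X.1
    rw [Matrix.transpose_neg, Matrix.transpose_transpose, neg_neg])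

theorem coe_negTranspose_apply (X : LieAlgebra.SpecialLinear.sl ι ℂ) :
    ((negTranspose ι X : LieAlgebra.SpecialLinear.sl ι ℂ) : Matrix ι ι ℂ)
      = -(X : Matrix ι ι ℂ)ᵀ := rfl

/-- If `Aᵀ B` is a scalar matrix, then `X ↦ -Xᵀ` conjugates `Ad_A` to `Ad_B`. -/
theorem negTranspose_conj_Ad {A B : GL ι ℂ} {c : ℂ}
    (h : (A : Matrix ι ι ℂ)ᵀ = c • (↑B⁻¹ : Matrix ι ι ℂ)) :
    negTranspose ι * Ad A * (negTranspose ι)⁻¹ = Ad B := by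
  rw [mul_inv_eq_iff_eq_mul]
  refine LieEquiv.ext fun X => Subtype.ext ?_
  rw [lieAut_mul_apply, lieAut_mul_apply, coe_negTranspose_apply, coe_Ad_apply, coe_Ad_apply,
    coe_negTranspose_apply, Matrix.transpose_mul, Matrix.transpose_mul, h]
  have h1 : (↑A⁻¹ : Matrix ι ι ℂ)ᵀ * (c • (↑B⁻¹ : Matrix ι ι ℂ)) = 1 := by
    rw [← h, ← Matrix.transpose_mul, Units.mul_inv, Matrix.transpose_one]
  have h2 : c • (↑A⁻¹ : Matrix ι ι ℂ)ᵀ = (B : Matrix ι ι ℂ) := by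
    calc c • (↑A⁻¹ : Matrix ι ι ℂ)ᵀ
        = (↑A⁻¹ : Matrix ι ι ℂ)ᵀ * (c • (↑B⁻¹ : Matrix ι ι ℂ)) * (B : Matrix ι ι ℂ) := by
          rw [Matrix.mul_smul, Matrix.smul_mul, Matrix.mul_assoc, Units.inv_mul, Matrix.mul_one]
      _ = _ := by rw [h1, Matrix.one_mul]
  rw [← h2, Matrix.smul_mul, Matrix.mul_smul, Matrix.mul_neg, Matrix.neg_mul, smul_neg,
    Matrix.mul_assoc]

variable {n : ℕ}

variable (n) in
/-- The diagonal matrix by which `X ↦ -Xᵀ` acts on the labels of the Pauli monomials. -/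
def signMatrix : Matrix (Fin 4) (Fin 4) (ZMod n) := Matrix.diagonal ![-1, 1, -1, 1]

theorem signMatrix_mulVec (v : Fin 4 → ZMod n) :
    signMatrix n *ᵥ v = ![-v 0, v 1, -v 2, v 3] := by
  funext i
  rw [signMatrix, Matrix.mulVec_diagonal]
  fin_cases i <;> simp

theorem signMatrix_mul_self : signMatrix n * signMatrix n = 1 := by
  rw [signMatrix, Matrix.diagonal_mul_diagonal, ← Matrix.diagonal_one]
  congr 1
  funext i
  fin_cases i <;> simp

theorem conj_J_signMatrix : (signMatrix n)ᵀ * J n * signMatrix n = -J n := by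
  rw [signMatrix, Matrix.diagonal_transpose]
  ext i j
  rw [Matrix.mul_diagonal, Matrix.diagonal_mul]
  fin_cases i <;> fin_cases j <;> simp [J]

variable [NeZero n]

theorem mon_transpose (v : Fin 4 → ZMod n) :
    (mon n v)ᵀ = e n (-(v 0 * v 1 + v 2 * v 3)) • mon n (-(signMatrix n *ᵥ v)) := by
  ext p q
  rw [Matrix.transpose_apply, Matrix.smul_apply, mon_apply, mon_apply, signMatrix_mulVec]
  by_cases h : p = q + (v 1, v 3)
  · have h' : q = p + (-v 1, -v 3) := by
      rw [h, add_assoc, Prod.mk_add_mk]; ext <;> simp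
    rw [if_pos h, if_pos (by simpa using h'), smul_eq_mul, ← AddChar.map_add_eq_mul]
    congr 1
    rw [h]
    simp
    ring
  · have h' : q ≠ p + (-v 1, -v 3) := fun h' => h (by
      rw [h', add_assoc, Prod.mk_add_mk]; ext <;> simp)
    rw [if_neg h, if_neg (by simpa using h'), smul_zero]

theorem negTranspose_conj_mon (v : Fin 4 → ZMod n) :
    negTranspose (ZMod n × ZMod n) * Ad (pauliMonomial n v) * (negTranspose (ZMod n × ZMod n))⁻¹
      = Ad (pauliMonomial n (signMatrix n *ᵥ v)) := by
  set w := signMatrix n *ᵥ v with hw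
  refine negTranspose_conj_Ad (c := e n (-(v 0 * v 1 + v 2 * v 3)) * e n (beta (-w) w)) ?_
  have h1 : mon n (-w) * mon n w = e n (beta (-w) w) • 1 := by
    rw [mon_mul, neg_add_cancel, mon_zero]
  have h2 : mon n (-w) = e n (beta (-w) w) • (↑(pauliMonomial n w)⁻¹ : Matrix _ _ ℂ) := by
    calc mon n (-w) = mon n (-w) * mon n w * (↑(pauliMonomial n w)⁻¹ : Matrix _ _ ℂ) := by
          rw [Matrix.mul_assoc, Units.mul_inv, Matrix.mul_one]
      _ = _ := by rw [h1, Matrix.smul_mul, Matrix.one_mul]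
  change (mon n v)ᵀ = _
  rw [mon_transpose, ← hw, h2, smul_smul]

variable (n) in
/-- The automorphism `X ↦ -Xᵀ` as an element of `𝒩(𝒢)`. -/
def outer : N n := ⟨negTranspose _, mem_N_of_conj signMatrix_mul_self negTranspose_conj_mon⟩

theorem C_outer : C n (outer n) = signMatrix n := C_eq_of_conj negTranspose_conj_mon

theorem hat_outer_mon {v : Fin 4 → ZMod n} (hv : v ≠ 0) :
    hat (outer n : AutSl n) (mon n v) = -(mon n v)ᵀ :=
  hat_coe (negTranspose (ZMod n × ZMod n)) ⟨mon n v, trace_mon hv⟩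

end Outer

/-! ### The kernel of `φ ↦ C(φ)` -/

section Characters

variable {n : ℕ} [NeZero n]

/-- Every multiplicative function on `(ℤ/n)⁴` is `u ↦ ω ^ (vᵀ J u)` for some `v`: there are as many
characters as elements, and the symplectic form is nondegenerate. -/
theorem exists_eq_e_sform {c : (Fin 4 → ZMod n) → ℂ} (h0 : c 0 = 1)
    (h : ∀ u v, c (u + v) = c u * c v) : ∃ v, ∀ u, c u = e n (sform v u) := by
  let F : (Fin 4 → ZMod n) → AddChar (Fin 4 → ZMod n) ℂ := fun v =>
    { toFun := fun u => e n (sform v u)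
      map_zero_eq_one' := by rw [sform_zero_right, AddChar.map_zero_eq_one]
      map_add_eq_mul' := fun u w => by rw [sform_add_right, AddChar.map_add_eq_mul] }
  have hF : Function.Injective F := by
    intro v w hvw
    refine eq_of_forall_sform_eq fun u => ?_
    have h1 : e n (sform v u) = e n (sform w u) := DFunLike.congr_fun hvw u
    rw [sform_swap, sform_swap u w, e_injective h1]
  obtain ⟨v, hv⟩ := ((Fintype.bijective_iff_injective_and_card F).2
    ⟨hF, AddChar.card_eq.symm⟩).2 ⟨c, h0, h⟩
  exact ⟨v, fun u => (DFunLike.congr_fun hv u).symm⟩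

theorem mem_madGroup_of_weights {φ : AutSl n} {v : Fin 4 → ZMod n}
    (h : ∀ u, hat φ (mon n u) = e n (sform v u) • mon n u) : φ ∈ madGroup n := by
  have : φ = Ad (pauliMonomial n v) := by
    refine hat_injective fun Y => LinearMap.congr_fun ((monBasis n).ext fun u => ?_) Y
    rw [monBasis_apply, h, hat_Ad, mon_conj]
  rw [this]
  exact Ad_mon_mem n v

theorem mem_madGroup_of_multiplicative {φ : AutSl n} {c : (Fin 4 → ZMod n) → ℂ}
    (hc : ∀ u, hat φ (mon n u) = c u • mon n u) (h0 : c 0 = 1)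
    (h : ∀ u v, c (u + v) = c u * c v) : φ ∈ madGroup n := by
  obtain ⟨v, hv⟩ := exists_eq_e_sform h0 h
  exact mem_madGroup_of_weights (v := v) fun u => by rw [hc, hv]

theorem C_eq_one_of_mem {φ : N n} (h : φ ∈ GinN n) : C n φ = 1 := by
  obtain ⟨v, hv⟩ := exists_monomial n (show (φ : AutSl n) ∈ madGroup n from h)
  refine C_eq_of_conj fun w => ?_
  rw [hv, ← Ad_mon_add, add_comm, Ad_mon_add, mul_inv_cancel_right, Matrix.one_mulVec]

theorem mem_Nin_of_mem_GinN {φ : N n} (h : φ ∈ GinN n) : φ ∈ Nin n := by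
  obtain ⟨v, hv⟩ := exists_monomial n (show (φ : AutSl n) ∈ madGroup n from h)
  exact ⟨_, hv⟩

/-- If `C(φ) = 1`, then `φ` is diagonal in the basis of Pauli monomials, with eigenvalues which are
multiplicative on noncommuting pairs. -/
theorem exists_weights_of_C_eq_one {φ : N n} (h : C n φ = 1) :
    ∃ c : (Fin 4 → ZMod n) → ℂ, c 0 = 1 ∧ (∀ u, c u ≠ 0) ∧
      (∀ u, hat (φ : AutSl n) (mon n u) = c u • mon n u) ∧
      ∀ u v, sform u v ≠ 0 → c (u + v) = c u * c v := by
  obtain ⟨D, c, hD, h0, hc0, hc⟩ := exists_weights φ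
  have hDu : ∀ u, D *ᵥ u = u := fun u => eq_of_forall_sform_eq fun v => by
    rw [← hD u v, h, Matrix.one_mulVec]
  refine ⟨c, h0, hc0, fun u => by rw [hc, hDu], fun u v huv => ?_⟩
  have h1 := weights_commutator hc u v
  rw [hDu, hDu] at h1
  have h2 : 1 - e n (sform u v) ≠ 0 := sub_ne_zero.2 fun h3 => huv (e_eq_one_iff.1 h3.symm)
  exact (mul_right_cancel₀ h2 (mul_right_cancel₀ (e_ne_zero _) h1)).symm

theorem mem_GinN_of_inner {φ : N n} (hφ : φ ∈ Nin n) (h : C n φ = 1) : φ ∈ GinN n := by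
  obtain ⟨c, h0, -, hc, -⟩ := exists_weights_of_C_eq_one h
  refine mem_madGroup_of_multiplicative hc h0 fun u v => ?_
  have h1 := hat_mul_of_inner (φ := (φ : AutSl n)) hφ (mon n u) (mon n v)
  rw [hc, hc, Matrix.smul_mul, Matrix.mul_smul, mon_mul, map_smul, hc] at h1
  simp only [smul_smul] at h1
  have h2 := smul_left_injective ℂ (mon_ne_zero _) h1
  refine mul_left_cancel₀ (e_ne_zero (beta u v)) ?_
  linear_combination h2

theorem mem_GinN_iff {φ : N n} : φ ∈ GinN n ↔ φ ∈ Nin n ∧ C n φ = 1 :=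
  ⟨fun h => ⟨mem_Nin_of_mem_GinN h, C_eq_one_of_mem h⟩, fun h => mem_GinN_of_inner h.1 h.2⟩

end Characters

section Odd

variable {n : ℕ} [Fact n.Prime]

/-- For odd `n`, three hyperplanes `u^⊥`, `v^⊥`, `(u + v)^⊥` do not cover the space. -/
theorem exists_noncommuting (hn : n ≠ 2) {u v : Fin 4 → ZMod n} (hu : u ≠ 0) (hv : v ≠ 0)
    (huv : u + v ≠ 0) : ∃ w, sform u w ≠ 0 ∧ sform v w ≠ 0 ∧ sform (u + v) w ≠ 0 := by
  have h2 : (2 : ZMod n) ≠ 0 := by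
    intro h
    have h1 : ((2 : ℕ) : ZMod n) = 0 := by exact_mod_cast h
    rw [ZMod.natCast_eq_zero_iff] at h1
    exact hn ((Nat.prime_dvd_prime_iff_eq Fact.out Nat.prime_two).1 h1)
  obtain ⟨w₀, hw₀⟩ := exists_sform_ne_zero hu
  obtain ⟨w, huw⟩ : ∃ w, sform u w = 1 :=
    ⟨(sform u w₀)⁻¹ • w₀, by rw [sform_smul_right, inv_mul_cancel₀ hw₀]⟩
  by_cases hind : ∀ z, sform v z = sform v w * sform u z
  · -- here `v` is a multiple of `u`
    have hmul : ∀ z, sform (u + v) z = (1 + sform v w) * sform u z := by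
      intro z
      rw [sform_add_left, hind z]; ring
    have key : ∀ (x : Fin 4 → ZMod n) (a : ZMod n), x ≠ 0 → (∀ z, sform x z = a * sform u z) →
        a ≠ 0 := by
      rintro x a hx h rfl
      obtain ⟨z, hz⟩ := exists_sform_ne_zero hx
      exact hz (by rw [h, zero_mul])
    refine ⟨w, by rw [huw]; exact one_ne_zero, key v _ hv hind, ?_⟩
    rw [hmul, huw, mul_one]
    exact key _ _ huv hmul
  · push Not at hind
    obtain ⟨z₀, hz₀⟩ := hind
    have hz₀' : sform v z₀ - sform u z₀ * sform v w ≠ 0 := fun h => hz₀ (by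
      linear_combination h)
    set z := z₀ + (-sform u z₀) • w with hz
    have huz : sform u z = 0 := by
      rw [hz, sform_add_right, sform_smul_right, huw]; ring
    have hvz : sform v z ≠ 0 := by
      rw [hz, sform_add_right, sform_smul_right]
      intro h
      exact hz₀' (by linear_combination h)
    -- the pairings of `x` with `u` and `v` are both `1`, so that the one with `u + v` is `2`
    set x := w + ((1 - sform v w) / sform v z) • z with hx
    have hux : sform u x = 1 := by
      rw [hx, sform_add_right, sform_smul_right, huw, huz, mul_zero, add_zero]
    have hvx : sform v x = 1 := by
      rw [hx, sform_add_right, sform_smul_right, div_mul_cancel₀ _ hvz]; ring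
    refine ⟨x, by rw [hux]; exact one_ne_zero, by rw [hvx]; exact one_ne_zero, ?_⟩
    rw [sform_add_left, hux, hvx, one_add_one_eq_two]
    exact h2

/-- For odd `n`, a function which is multiplicative on the pairs with `uᵀ J v ≠ 0` is
multiplicative. -/
theorem multiplicative_of_noncommuting (hn : n ≠ 2) {c : (Fin 4 → ZMod n) → ℂ} (h0 : c 0 = 1)
    (hc0 : ∀ u, c u ≠ 0) (hc : ∀ u v, sform u v ≠ 0 → c (u + v) = c u * c v)
    (u v : Fin 4 → ZMod n) : c (u + v) = c u * c v := by
  by_cases huv : sform u v ≠ 0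
  · exact hc u v huv
  rw [not_not] at huv
  by_cases hu : u = 0
  · rw [hu, zero_add, h0, one_mul]
  by_cases hv : v = 0
  · rw [hv, add_zero, h0, mul_one]
  by_cases hs : u + v = 0
  · obtain ⟨w, hw⟩ := exists_sform_ne_zero hv
    have huw : sform u (v + w) ≠ 0 := by
      rw [eq_neg_of_add_eq_zero_left hs, ← neg_one_smul (ZMod n) v, sform_smul_left,
        sform_add_right, sform_self, zero_add]
      exact mul_ne_zero (neg_ne_zero.2 one_ne_zero) hw
    have h1 := hc u (v + w) huw
    rw [hc v w hw, ← add_assoc, hs, zero_add, ← mul_assoc] at h1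
    rw [hs, h0]
    exact mul_right_cancel₀ (hc0 w) (by rw [one_mul]; exact h1)
  · obtain ⟨w, hw1, hw2, hw3⟩ := exists_noncommuting hn hu hv hs
    have h1 := hc (u + v) w hw3
    rw [add_assoc, hc u (v + w) (by rwa [sform_add_right, huv, zero_add]), hc v w hw2,
      ← mul_assoc] at h1
    exact (mul_right_cancel₀ (hc0 w) h1).symm

theorem mem_GinN_of_C_eq_one (hn : n ≠ 2) {φ : N n} (h : C n φ = 1) : φ ∈ GinN n := by
  obtain ⟨c, h0, hc0, hc, hcc⟩ := exists_weights_of_C_eq_one h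
  exact mem_madGroup_of_multiplicative hc h0 (multiplicative_of_noncommuting hn h0 hc0 hcc)

end Odd

section Two

/-- For `n = 2`, the noncommuting sums of `e₀`, `e₁`, `e₂`, `e₃` and `e₀ + e₂` exhaust the nonzero
labels. -/
theorem eq_one_of_generators {r : (Fin 4 → ZMod 2) → ℂ} (h0 : r 0 = 1)
    (hr : ∀ u v, sform u v ≠ 0 → r (u + v) = r u * r v) (hE : ∀ i, r (Pi.single i 1) = 1)
    (hE02 : r (Pi.single 0 1 + Pi.single 2 1) = 1) (v : Fin 4 → ZMod 2) : r v = 1 := by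
  have step : ∀ {u v : Fin 4 → ZMod 2} (w : Fin 4 → ZMod 2), r u = 1 → r v = 1 →
      sform u v ≠ 0 → u + v = w → r w = 1 := by
    rintro u v _ h1 h2 h3 rfl
    rw [hr u v h3, h1, h2, one_mul]
  have e0 : r ![1, 0, 0, 0] = 1 := by convert hE 0 using 2; decide
  have e1 : r ![0, 1, 0, 0] = 1 := by convert hE 1 using 2; decide
  have e2 : r ![0, 0, 1, 0] = 1 := by convert hE 2 using 2; decide
  have e3 : r ![0, 0, 0, 1] = 1 := by convert hE 3 using 2; decide
  have e02 : r ![1, 0, 1, 0] = 1 := by convert hE02 using 2; decide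
  have e01 := step ![1, 1, 0, 0] e0 e1 (by decide) (by decide)
  have e23 := step ![0, 0, 1, 1] e2 e3 (by decide) (by decide)
  have e012 := step ![1, 1, 1, 0] e1 e02 (by decide) (by decide)
  have e023 := step ![1, 0, 1, 1] e3 e02 (by decide) (by decide)
  have e12 := step ![0, 1, 1, 0] e0 e012 (by decide) (by decide)
  have e03 := step ![1, 0, 0, 1] e2 e023 (by decide) (by decide)
  have e13 := step ![0, 1, 0, 1] e01 e03 (by decide) (by decide)
  have e123 := step ![0, 1, 1, 1] e3 e12 (by decide) (by decide)
  have e013 := step ![1, 1, 0, 1] e1 e03 (by decide) (by decide)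
  have e0123 := step ![1, 1, 1, 1] e3 e012 (by decide) (by decide)
  have e_ : r ![0, 0, 0, 0] = 1 := by convert h0 using 2; decide
  have hv : v = ![v 0, v 1, v 2, v 3] := by
    funext i
    fin_cases i <;> rfl
  rw [hv]
  have hcase : ∀ a : ZMod 2, a = 0 ∨ a = 1 := by decide
  rcases hcase (v 0) with h | h <;> rcases hcase (v 1) with h' | h' <;>
    rcases hcase (v 2) with h'' | h'' <;> rcases hcase (v 3) with h''' | h''' <;>
    rw [h, h', h'', h'''] <;> assumption

theorem e_two_one : e 2 1 = -1 := by
  have h1 : e 2 1 * e 2 1 = 1 := by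
    rw [← AddChar.map_add_eq_mul, show (1 : ZMod 2) + 1 = 0 by decide, AddChar.map_zero_eq_one]
  rcases mul_self_eq_one_iff.1 h1 with h | h
  · exact absurd (e_eq_one_iff.1 h) (by decide)
  · exact h

theorem neg_eq_self_two (v : Fin 4 → ZMod 2) : -v = v := by
  funext i
  exact ZMod.neg_eq_self_mod_two (v i)

/-- For `n = 2` the weights are signs: if `uᵀ J v ≠ 0`, then `v = u + (u + v)` is a noncommuting sum
as well. -/
theorem weight_sq_two {c : (Fin 4 → ZMod 2) → ℂ} (h0 : c 0 = 1) (hc0 : ∀ u, c u ≠ 0)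
    (hc : ∀ u v, sform u v ≠ 0 → c (u + v) = c u * c v) (u : Fin 4 → ZMod 2) :
    c u * c u = 1 := by
  by_cases hu : u = 0
  · rw [hu, h0, one_mul]
  obtain ⟨v, hv⟩ := exists_sform_ne_zero hu
  have h1 := hc u (u + v) (by rwa [sform_add_right, sform_self, zero_add])
  rw [hc u v hv, ← add_assoc] at h1
  have h2 : u + u = 0 := by
    nth_rw 1 [← neg_eq_self_two u]
    exact neg_add_cancel u
  rw [h2, zero_add, ← mul_assoc] at h1
  exact mul_right_cancel₀ (hc0 v) (by rw [one_mul]; exact h1.symm)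

/-- For `n = 2`, multiplicativity at one commuting pair suffices besides that on noncommuting
pairs. -/
theorem exists_eq_e_sform_two {c : (Fin 4 → ZMod 2) → ℂ} (h0 : c 0 = 1) (hc0 : ∀ u, c u ≠ 0)
    (hc : ∀ u v, sform u v ≠ 0 → c (u + v) = c u * c v)
    (h02 : c (Pi.single 0 1 + Pi.single 2 1) = c (Pi.single 0 1) * c (Pi.single 2 1)) :
    ∃ v, ∀ u, c u = e 2 (sform v u) := by
  have hsq := weight_sq_two h0 hc0 hc
  have ha : ∀ i : Fin 4, ∃ a : ZMod 2, c (Pi.single i 1) = e 2 a := by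
    intro i
    rcases mul_self_eq_one_iff.1 (hsq (Pi.single i 1)) with h | h
    · exact ⟨0, by rw [h, AddChar.map_zero_eq_one]⟩
    · exact ⟨1, by rw [h, e_two_one]⟩
  choose a ha using ha
  set w : Fin 4 → ZMod 2 := ![a 1, -a 0, a 3, -a 2] with hw
  have hwE : ∀ i, sform w (Pi.single i 1) = a i := by
    intro i
    fin_cases i <;> simp [sform, hw]
  have hr := eq_one_of_generators (r := fun u => c u * e 2 (-sform w u)) (by
      simp [h0, sform_zero_right])
    (fun u v huv => by
      simp only [hc u v huv, sform_add_right, neg_add, AddChar.map_add_eq_mul]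
      ring)
    (fun i => by
      simp only [hwE, ha, ← AddChar.map_add_eq_mul, add_neg_cancel, AddChar.map_zero_eq_one])
    (by
      simp only [h02, sform_add_right, hwE, ha, ← AddChar.map_add_eq_mul]
      rw [add_neg_cancel, AddChar.map_zero_eq_one])
  refine ⟨w, fun u => ?_⟩
  have h1 : c u * e 2 (-sform w u) = 1 := hr u
  have h2 : e 2 (sform w u) * e 2 (-sform w u) = 1 := by
    rw [← AddChar.map_add_eq_mul, add_neg_cancel, AddChar.map_zero_eq_one]
  exact mul_right_cancel₀ (e_ne_zero _) (h1.trans h2.symm)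

theorem signMatrix_two : signMatrix 2 = 1 := by
  rw [signMatrix, ← Matrix.diagonal_one]
  congr 1
  funext i
  fin_cases i <;> rfl

theorem hat_outer_mon_two {v : Fin 4 → ZMod 2} (hv : v ≠ 0) :
    hat (outer 2 : AutSl 2) (mon 2 v) = (-e 2 (v 0 * v 1 + v 2 * v 3)) • mon 2 v := by
  rw [hat_outer_mon hv, mon_transpose, signMatrix_two, Matrix.one_mulVec, neg_eq_self_two,
    ZMod.neg_eq_self_mod_two, neg_smul]

theorem hat_outer_two_single :
    hat (outer 2 : AutSl 2) (mon 2 (Pi.single 0 1)) = (-1 : ℂ) • mon 2 (Pi.single 0 1) ∧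
    hat (outer 2 : AutSl 2) (mon 2 (Pi.single 2 1)) = (-1 : ℂ) • mon 2 (Pi.single 2 1) ∧
    hat (outer 2 : AutSl 2) (mon 2 (Pi.single 0 1 + Pi.single 2 1))
      = (-1 : ℂ) • mon 2 (Pi.single 0 1 + Pi.single 2 1) := by
  refine ⟨?_, ?_, ?_⟩ <;> rw [hat_outer_mon_two (by decide)] <;> congr 2 <;>
    simp

/-- For `n = 2`, the automorphism `X ↦ -Xᵀ` is not inner: it changes the signs of `P ⊗ I`, `I ⊗ P`
and of their product. -/
theorem outer_two_notMem_Nin : outer 2 ∉ Nin 2 := by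
  intro h
  obtain ⟨h0, h2, h02⟩ := hat_outer_two_single
  have h1 := hat_mul_of_inner (φ := (outer 2 : AutSl 2)) h (mon 2 (Pi.single 0 1))
    (mon 2 (Pi.single 2 1))
  rw [h0, h2, Matrix.smul_mul, Matrix.mul_smul, mon_mul, map_smul, h02] at h1
  simp only [smul_smul] at h1
  have h3 := smul_left_injective ℂ (mon_ne_zero _) h1
  have h4 := e_ne_zero (beta (Pi.single 0 1 : Fin 4 → ZMod 2) (Pi.single 2 1))
  apply h4
  linear_combination (-1 / 2 : ℂ) * h3

/-- For `n = 2`, the kernel of `φ ↦ C(φ)` is generated by `𝒢` and `X ↦ -Xᵀ`: composition with the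
latter corrects the sign by which `c` can fail to be multiplicative at `(e₀, e₂)`. -/
theorem mem_GinN_or_mul_outer_two {φ : N 2} (h : C 2 φ = 1) :
    φ ∈ GinN 2 ∨ φ * outer 2 ∈ GinN 2 := by
  have main : ∀ (ψ : N 2) (a0 a2 a02 : ℂ), C 2 ψ = 1 →
      hat (ψ : AutSl 2) (mon 2 (Pi.single 0 1)) = a0 • mon 2 (Pi.single 0 1) →
      hat (ψ : AutSl 2) (mon 2 (Pi.single 2 1)) = a2 • mon 2 (Pi.single 2 1) →
      hat (ψ : AutSl 2) (mon 2 (Pi.single 0 1 + Pi.single 2 1))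
        = a02 • mon 2 (Pi.single 0 1 + Pi.single 2 1) → a02 = a0 * a2 → ψ ∈ GinN 2 := by
    intro ψ a0 a2 a02 hC h0 h2 h02 ha
    obtain ⟨c, hc1, hc0, hc, hcc⟩ := exists_weights_of_C_eq_one hC
    rw [hc] at h0 h2 h02
    have e0 := smul_left_injective ℂ (mon_ne_zero _) h0
    have e2 := smul_left_injective ℂ (mon_ne_zero _) h2
    have e02 := smul_left_injective ℂ (mon_ne_zero _) h02
    obtain ⟨v, hv⟩ := exists_eq_e_sform_two hc1 hc0 hcc (e02.trans (ha.trans (by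
      rw [← show c _ = a0 from e0, ← show c _ = a2 from e2])))
    exact mem_madGroup_of_weights (v := v) fun u => (hc u).trans (by rw [hv])
  obtain ⟨c, hc1, hc0, hc, hcc⟩ := exists_weights_of_C_eq_one h
  have hsq := weight_sq_two hc1 hc0 hcc
  set t := c (Pi.single 0 1 + Pi.single 2 1) with ht
  have hcase : t = c (Pi.single 0 1) * c (Pi.single 2 1) ∨
      t = -(c (Pi.single 0 1) * c (Pi.single 2 1)) := by
    apply mul_self_eq_mul_self_iff.1
    rw [ht, hsq, mul_mul_mul_comm, hsq, hsq, one_mul]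
  rcases hcase with hcase | hcase
  · exact Or.inl (main φ _ _ _ h (hc _) (hc _) (hc _) hcase)
  · obtain ⟨h0, h2, h02⟩ := hat_outer_two_single
    refine Or.inr (main (φ * outer 2) (-c (Pi.single 0 1)) (-c (Pi.single 2 1)) (-t) ?_ ?_ ?_ ?_ ?_)
    · rw [C_mul, h, C_outer, signMatrix_two, one_mul]
    · rw [Subgroup.coe_mul, hat_mul, h0, map_smul, hc, smul_smul, neg_one_mul]
    · rw [Subgroup.coe_mul, hat_mul, h2, map_smul, hc, smul_smul, neg_one_mul]
    · rw [Subgroup.coe_mul, hat_mul, h02, map_smul, hc, smul_smul, neg_one_mul]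
    · rw [hcase]; ring

end Two

/-! ### The quotients by `𝒢` -/

section Quotients

variable {n : ℕ} [Fact n.Prime]

variable (n) in
/-- The map `φ ↦ C(φ)` from `𝒩_in(𝒢)` to the symplectic group. -/
def innerToSp4 : Nin n →* Sp4 n :=
  ((CHom n).comp (Nin n).subtype).codRestrict (Sp4 n) fun φ => conj_J_C_of_inner φ.2

theorem innerToSp4_surjective : Function.Surjective (innerToSp4 n) := by
  rintro ⟨X, hX⟩
  obtain ⟨φ, hφ, hC⟩ := exists_inner_of_conj_J hX
  exact ⟨⟨φ, hφ⟩, Subtype.ext (Units.ext hC)⟩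

theorem ker_innerToSp4 : (GinN n).subgroupOf (Nin n) = (innerToSp4 n).ker := by
  ext φ
  rw [Subgroup.mem_subgroupOf, mem_GinN_iff, MonoidHom.mem_ker, Subtype.ext_iff, Units.ext_iff]
  exact ⟨fun h => h.2, fun h => ⟨φ.2, h⟩⟩

variable (n) in
/-- The map `φ ↦ C(φ)` from `𝒩(𝒢)` to the group of matrices `X` with `Xᵀ J X = ± J`. -/
def toSpPM4 : N n →* SpPM4 n := (CHom n).codRestrict (SpPM4 n) conj_J_C

theorem toSpPM4_surjective : Function.Surjective (toSpPM4 n) := by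
  rintro ⟨X, hX⟩
  rcases hX with hX | hX
  · obtain ⟨φ, -, hC⟩ := exists_inner_of_conj_J hX
    exact ⟨φ, Subtype.ext (Units.ext hC)⟩
  · set M : Matrix (Fin 4) (Fin 4) (ZMod n) := X.val with hM
    have hX' : (signMatrix n * M)ᵀ * J n * (signMatrix n * M) = J n := by
      calc (signMatrix n * M)ᵀ * J n * (signMatrix n * M)
          = Mᵀ * ((signMatrix n)ᵀ * J n * signMatrix n) * M := by
            rw [Matrix.transpose_mul]; simp only [Matrix.mul_assoc]
        _ = J n := by rw [conj_J_signMatrix, Matrix.mul_neg, Matrix.neg_mul, hX, neg_neg]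
    obtain ⟨φ, -, hC⟩ := exists_inner_of_conj_J hX'
    refine ⟨outer n * φ, Subtype.ext (Units.ext ?_)⟩
    change C n (outer n * φ) = M
    rw [C_mul, C_outer, hC, ← Matrix.mul_assoc, signMatrix_mul_self, Matrix.one_mul]

theorem ker_toSpPM4 (hn : n ≠ 2) : GinN n = (toSpPM4 n).ker := by
  ext φ
  rw [MonoidHom.mem_ker, Subtype.ext_iff, Units.ext_iff]
  exact ⟨C_eq_one_of_mem, mem_GinN_of_C_eq_one hn⟩

theorem conj_J_C_two (φ : N 2) : (C 2 φ)ᵀ * J 2 * C 2 φ = J 2 := by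
  rcases conj_J_C φ with h | h
  · exact h
  · rw [h]
    ext i j
    exact ZMod.neg_eq_self_mod_two _

/-- For `n = 2`, every element of `𝒩(𝒢)` has the same coefficient matrix as an inner one, so that it
is inner up to a factor `X ↦ -Xᵀ`. -/
theorem index_Nin_two : (Nin 2).index = 2 := by
  rw [Subgroup.index_eq_two_iff_exists_notMem_and]
  refine ⟨outer 2, outer_two_notMem_Nin, fun φ => ?_⟩
  obtain ⟨ψ, hψ, hC⟩ := exists_inner_of_conj_J (conj_J_C_two φ)
  have h1 : C 2 (ψ⁻¹ * φ) = 1 := by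
    rw [C_mul, ← hC, ← C_mul, inv_mul_cancel, C_one]
  rcases mem_GinN_or_mul_outer_two h1 with h | h
  · refine Or.inr ?_
    have := mul_mem hψ (mem_Nin_of_mem_GinN h)
    rwa [mul_inv_cancel_left] at this
  · refine Or.inl ?_
    have := mul_mem hψ (mem_Nin_of_mem_GinN h)
    rwa [mul_assoc, mul_inv_cancel_left] at this

open Classical in
/-- The character of a subgroup of index two. -/
def indexTwoCharacter {G : Type*} [Group G] {H : Subgroup G} (h : H.index = 2) :
    G →* Multiplicative (ZMod 2) where
  toFun g := if g ∈ H then 1 else Multiplicative.ofAdd 1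
  map_one' := if_pos (one_mem H)
  map_mul' a b := by
    have h2 : (Multiplicative.ofAdd 1 * Multiplicative.ofAdd 1 : Multiplicative (ZMod 2)) = 1 := by
      decide
    by_cases ha : a ∈ H <;> by_cases hb : b ∈ H <;>
      simp [Subgroup.mul_mem_iff_of_index_two h, ha, hb, h2]

open Classical in
theorem indexTwoCharacter_eq_one_iff {G : Type*} [Group G] {H : Subgroup G} (h : H.index = 2)
    {g : G} : indexTwoCharacter h g = 1 ↔ g ∈ H := by
  have h1 : (Multiplicative.ofAdd 1 : Multiplicative (ZMod 2)) ≠ 1 := by decide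
  change (if g ∈ H then 1 else Multiplicative.ofAdd 1 : Multiplicative (ZMod 2)) = 1 ↔ g ∈ H
  by_cases hg : g ∈ H <;> simp [hg, h1]

/-- The map `φ ↦ (C(φ), ε(φ))` for `n = 2`. -/
def toSp4Prod : N 2 →* Sp4 2 × Multiplicative (ZMod 2) :=
  ((CHom 2).codRestrict (Sp4 2) conj_J_C_two).prod (indexTwoCharacter index_Nin_two)

theorem toSp4Prod_surjective : Function.Surjective toSp4Prod := by
  rintro ⟨⟨X, hX⟩, t⟩
  obtain ⟨φ, hφ, hC⟩ := exists_inner_of_conj_J hX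
  have hcase : ∀ a b : Multiplicative (ZMod 2), a ≠ 1 → b ≠ 1 → a = b := by decide
  by_cases ht : t = 1
  · refine ⟨φ, Prod.ext (Subtype.ext (Units.ext hC)) ?_⟩
    exact ((indexTwoCharacter_eq_one_iff index_Nin_two).2 hφ).trans ht.symm
  · refine ⟨φ * outer 2, Prod.ext (Subtype.ext (Units.ext ?_)) (hcase _ _ ?_ ht)⟩
    · change C 2 (φ * outer 2) = X
      rw [C_mul, C_outer, signMatrix_two, mul_one, hC]
    · intro h
      have h1 := (indexTwoCharacter_eq_one_iff index_Nin_two).1 h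
      exact outer_two_notMem_Nin ((Subgroup.mul_mem_cancel_left _ hφ).1 h1)

theorem ker_toSp4Prod : GinN 2 = toSp4Prod.ker := by
  ext φ
  rw [mem_GinN_iff, MonoidHom.mem_ker, Prod.ext_iff, Subtype.ext_iff, Units.ext_iff, and_comm]
  exact and_congr Iff.rfl (indexTwoCharacter_eq_one_iff index_Nin_two).symm

end Quotients

end PauliGrading

end

open PauliGrading in
theorem mainTheorem1 (n : ℕ) [Fact n.Prime] :
    (∃ Φ : (Nin n ⧸ (GinN n).subgroupOf (Nin n)) ≃* Sp4 n,
      ∀ φ : Nin n, ((Φ (QuotientGroup.mk φ) : GL (Fin 4) (ZMod n)) :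
        Matrix (Fin 4) (Fin 4) (ZMod n)) = C n φ) ∧
    (n ≠ 2 → ∃ Φ : (N n ⧸ GinN n) ≃* SpPM4 n,
      ∀ φ : N n, ((Φ (QuotientGroup.mk φ) : GL (Fin 4) (ZMod n)) :
        Matrix (Fin 4) (Fin 4) (ZMod n)) = C n φ) ∧
    (n = 2 → ∃ Φ : (N n ⧸ GinN n) ≃* Sp4 n × Multiplicative (ZMod 2),
      ∀ φ : N n, (((Φ (QuotientGroup.mk φ)).1 : GL (Fin 4) (ZMod n)) :
        Matrix (Fin 4) (Fin 4) (ZMod n)) = C n φ ∧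
        ((Φ (QuotientGroup.mk φ)).2 = 1 ↔ φ ∈ Nin n)) := by
  refine ⟨?_, fun hn => ?_, fun hn => ?_⟩
  · exact ⟨QuotientGroup.liftEquiv _ innerToSp4_surjective ker_innerToSp4, fun φ => rfl⟩
  · exact ⟨QuotientGroup.liftEquiv _ toSpPM4_surjective (ker_toSpPM4 hn), fun φ => rfl⟩
  · subst hn
    exact ⟨QuotientGroup.liftEquiv _ toSp4Prod_surjective ker_toSp4Prod, fun φ =>
      ⟨rfl, indexTwoCharacter_eq_one_iff index_Nin_two⟩⟩
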